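/- Let $d\ge 1$ and $\lambda>0$. The activated random walk (ARW) on $\mathbb{Z}^d$ with sleep rate $\lambda$ is the continuous-time Markov process with values in $\mathbb{S}^{\mathbb{Z}^d}$, where $\mathbb{S}=\{0,1,2,\dots\}\cup\{\mathfrak{s}\}$ (the number of active particles at a site, or one sleeping particle), and generator $$\mathcal{L}f(\eta)=\sum_{y}\lambda\big(f(\eta^{(y)})-f(\eta)\big)+\sum_{y\sim z}\eta(y)\big(f(\eta^{(y\to z)})-f(\eta)\big),$$ where the second sum is over ordered pairs of nearest neighbours and $\mathfrak{s}$ counts as $0$ in the factor $\eta(y)$. Here $\eta^{(y)}$ is $\eta$ with $\eta(y)$ replaced by $\mathfrak{s}$ if $\eta(y)=1$, and $\eta^{(y)}=\eta$ otherwise; if $\eta(y)\in\{1,2,\dots\}$, then $\eta^{(y\to z)}$ is $\eta$ with $\eta(y)$ replaced by $\eta(y)-1$ and $\eta(z)$ replaced by $\eta(z)+1$ (by $2$ if $\eta(z)=\mathfrak{s}$); otherwise $\eta^{(y\to z)}=\eta$. There is a constant $c>0$, depending only on $d$ and $\lambda$, such that for every $\epsilon>0$ there is a constant $c(\epsilon)>0$,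 depending only on $\epsilon$, $d$ and $\lambda$, with the following property. For $L\ge 1$, let $B_L=[0,L)^d\cap\mathbb{Z}^d$, let $B_L'=[L^{\epsilon},L-L^{\epsilon})^d\cap\mathbb{Z}^d$, let $\partial_i B_L=\{x\in B_L:\ d(x,\mathbb{Z}^d\setminus B_L)=1\}$, with $d(\cdot,\cdot)$ the supremum distance, and let $\mathbb{P}_L$ be the law of the ARW started from a Poisson point process of active particles on $B_L'$ with density $L^{-\epsilon}$ (independent Poisson($L^{-\epsilon}$) numbers of active particles at the sites of $B_L'$, and no other particles). Then $$\mathbb{P}_L\big[\text{some particle reaches }\partial_i B_L\big]\le c(\epsilon)\exp\big\{-c\,L^{\epsilon/(4d)}\big\}.$$ -/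

import Mathlib

open MeasureTheory ProbabilityTheory
open scoped ENNReal NNReal

noncomputable section

namespace ARW

/-! ### Lattice, boxes, internal boundary -/

/-- The lattice `ℤ^d`; its `dist` is the supremum distance. -/
abbrev Site (d : ℕ) := Fin d → ℤ

/-- The lattice box `[a, b)^d ∩ ℤ^d`, for real `a` and `b`. -/
def latticeBox (d : ℕ) (a b : ℝ) : Finset (Site d) :=
  Fintype.piFinset fun _ => Finset.Ico ⌈a⌉ ⌈b⌉

theorem mem_latticeBox {d : ℕ} {a b : ℝ} {x : Site d} :
    x ∈ latticeBox d a b ↔ ∀ i, a ≤ (x i : ℝ) ∧ (x i : ℝ) < b := by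
  simp [latticeBox, Fintype.mem_piFinset, Finset.mem_Ico, Int.ceil_le, Int.lt_ceil]

/-- The internal boundary `{x ∈ A ; d(x, ℤ^d \ A) = 1}`. -/
def innerBoundary {d : ℕ} (A : Set (Site d)) : Set (Site d) :=
  {x | x ∈ A ∧ Metric.infDist x Aᶜ = 1}

/-! ### Configurations -/

/-- The state of a site: one sleeping particle, or `n ≥ 0` active particles. -/
inductive SiteState
  | sleeping : SiteState
  | active (n : ℕ) : SiteState

namespace SiteState

/-- The empty site is the zero state. -/
instance : Zero SiteState := ⟨active 0⟩

instance : Countable SiteState := by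
  have h : Function.Injective
      (fun s : SiteState => match s with | sleeping => (none : Option ℕ) | active n => some n) := by
    intro a b hab
    cases a <;> cases b <;> simp_all
  exact h.countable

/-- The number of active particles at a site (a sleeping particle counts as zero). -/
def numActive : SiteState → ℕ
  | sleeping => 0
  | active n => n

/-- The state after one active particle has left. -/
def removeOne : SiteState → SiteState
  | sleeping => sleeping
  | active n => active (n - 1)

/-- The state after an active particle has arrived; a sleeping particle is woken up. -/
def addOne : SiteState → SiteState
  | sleeping => active 2
  | active n => active (n + 1)

/-- The state after an attempt to sleep: only a lone active particle falls asleep. -/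
def trySleep : SiteState → SiteState
  | sleeping => sleeping
  | active n => if n = 1 then sleeping else active n

end SiteState

/-- Configurations with finitely many particles. -/
abbrev Config (d : ℕ) := Site d →₀ SiteState

/-- The set of configurations with finitely many particles is countable; it carries the discrete
σ-algebra. -/
instance (d : ℕ) : MeasurableSpace (Config d) := ⊤

instance (d : ℕ) : DiscreteMeasurableSpace (Config d) := ⟨fun _ => trivial⟩

/-- The configuration `η^(y)`: an attempt to sleep at `y`. -/
def sleepAt {d : ℕ} (η : Config d) (y : Site d) : Config d :=
  η.update y (η y).trySleep

/-- The configuration `η^(y → z)`: a jump attempt from `y` to a neighbour `z`. -/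
def jumpFromTo {d : ℕ} (η : Config d) (y z : Site d) : Config d :=
  if (η y).numActive = 0 then η
  else (η.update y (η y).removeOne).update z (η z).addOne

/-! ### The dynamics

The activated random walk is the continuous-time Markov chain with generator
`L f(η) = ∑_y λ (f(η^(y)) - f(η)) + ∑_{y ∼ z} η(y) (f(η^(y → z)) - f(η))`,
the second sum being over ordered pairs of nearest neighbours. -/

/-- The jump rates out of `η`, as a measure on configurations: the generator is
`L f(η) = ∫ (f(ξ) - f(η)) d(rates λ η)(ξ)`. Transitions that do not change `η` (attempts to sleep at
a site that does not hold exactly one active particle) have been left out. -/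
def rates {d : ℕ} (lam : ℝ) (η : Config d) : Measure (Config d) :=
  ∑ y ∈ η.support,
    ((if (η y).numActive = 1 then ENNReal.ofReal lam else 0) • Measure.dirac (sleepAt η y) +
      ∑ i : Fin d, ∑ s : ℤˣ,
        ((η y).numActive : ℝ≥0∞) • Measure.dirac (jumpFromTo η y (y + Pi.single i (s : ℤ))))

/-- The total jump rate out of `η`. -/
def totalRate {d : ℕ} (lam : ℝ) (η : Config d) : ℝ≥0∞ := rates lam η Set.univ

instance {d : ℕ} (lam : ℝ) (η : Config d) : IsFiniteMeasure (rates lam η) := by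
  constructor
  simp only [rates, Measure.coe_finsetSum, Finset.sum_apply, Measure.add_apply,
    Measure.smul_apply, measure_univ, smul_eq_mul, mul_one]
  refine ENNReal.sum_lt_top.2 fun y _ => ENNReal.add_lt_top.2 ⟨?_, ?_⟩
  · split_ifs <;> simp
  · exact ENNReal.sum_lt_top.2 fun i _ => ENNReal.sum_lt_top.2 fun s _ =>
      ENNReal.natCast_lt_top _

open Classical in
/-- One step of the jump chain: the new configuration is chosen with probability proportional to its
rate; a configuration without active particles is absorbing. -/
def jumpKernel (d : ℕ) (lam : ℝ) : Kernel (Config d) (Config d) :=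
  Kernel.ofFunOfCountable fun η =>
    if totalRate lam η = 0 then Measure.dirac η else (totalRate lam η)⁻¹ • rates lam η

instance (d : ℕ) (lam : ℝ) : IsMarkovKernel (jumpKernel d lam) := by
  constructor
  intro η
  change IsProbabilityMeasure (if totalRate lam η = 0 then Measure.dirac η
    else (totalRate lam η)⁻¹ • rates lam η)
  split_ifs with h
  · infer_instance
  · constructor
    rw [Measure.smul_apply, smul_eq_mul]
    exact ENNReal.inv_mul_cancel h (measure_ne_top _ _)

/-- The law of the jump chain `Y₀, Y₁, …` with initial law `μ`. -/
def jumpChain {d : ℕ} (lam : ℝ) (μ : Measure (Config d)) : Measure (ℕ → Config d) :=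
  Kernel.trajMeasure (X := fun _ => Config d) μ fun n =>
    (jumpKernel d lam).comap (fun h => h ⟨n, Finset.mem_Iic.2 le_rfl⟩) (measurable_pi_apply _)

instance : IsProbabilityMeasure (expMeasure 1) := isProbabilityMeasure_expMeasure one_pos

/-- The law of the process with initial law `μ`, on the space of pairs `((Yₙ), (Eₙ))`: the jump
chain together with independent standard exponential variables. -/
def law {d : ℕ} (lam : ℝ) (μ : Measure (Config d)) : Measure ((ℕ → Config d) × (ℕ → ℝ)) :=
  (jumpChain lam μ).prod (Measure.infinitePi fun _ : ℕ => expMeasure 1)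

/-- The time of the `n`-th jump: the chain stays in `Y_k` for a time `E_k / totalRate Y_k`, which is
infinite in an absorbing configuration. -/
def jumpTime {d : ℕ} (lam : ℝ) (ω : (ℕ → Config d) × (ℕ → ℝ)) (n : ℕ) : ℝ≥0∞ :=
  ∑ k ∈ Finset.range n, ENNReal.ofReal (ω.2 k) / totalRate lam (ω.1 k)

/-- The configuration `η_t` at time `t`: the state of the jump chain after the last jump before or
at time `t`. (Almost surely there is no explosion, as the number of particles is conserved.) -/
def path {d : ℕ} (lam : ℝ) (ω : (ℕ → Config d) × (ℕ → ℝ)) (t : ℝ≥0) : Config d :=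
  ω.1 (sSup {n : ℕ | jumpTime lam ω n ≤ t})

/-! ### Poisson initial condition -/

/-- The configuration in which the site `x ∈ B` holds `n x` active particles, and every other site is
empty. -/
def ofCounts {d : ℕ} (B : Finset (Site d)) (n : B → ℕ) : Config d := by
  classical
  exact Finsupp.onFinset B (fun x => if h : x ∈ B then SiteState.active (n ⟨x, h⟩) else 0)
    fun x hx => by
      by_contra h
      simp [h] at hx

/-- The law of the initial configuration given by a Poisson point process on the finite set `B` with
density `ρ`: independent Poisson(`ρ`) numbers of active particles at the sites of `B`. -/
def poissonConfig {d : ℕ} (B : Finset (Site d)) (ρ : ℝ≥0) : Measure (Config d) :=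
  (Measure.pi fun _ : B => poissonMeasure ρ).map (ofCounts B)

instance {d : ℕ} (B : Finset (Site d)) (ρ : ℝ≥0) : IsProbabilityMeasure (poissonConfig B ρ) :=
  Measure.isProbabilityMeasure_map Measurable.of_discrete.aemeasurable

instance {d : ℕ} (lam : ℝ) (μ : Measure (Config d)) [IsProbabilityMeasure μ] :
    IsProbabilityMeasure (law lam μ) := by
  unfold law jumpChain
  infer_instance

end ARW

end

/-!
The activated random walk with the Poisson initial condition does not reach the boundary because the
initial particles form small clusters that are far apart, and a small cluster falls asleep before it
has spread to the next one.

*The abelian property.* Instead of the process, one studies the value function `escape lam V` of a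
control problem: the supremum, over all strategies to topple sites with active particles, of the
probability that a particle ever leaves `V`. It is defined as the least escape bound, that is, the
least function that is at least one if a particle is outside `V` and that does not increase in mean
under a toppling of an active site. Along the jump chain it is a supermartingale, so that it bounds
the probability of an escape (`law_path_le`). As topplings of different sites commute, no strategy is
better than another one (`escape_le_toppleMean`), and waking particles up only helps them to escape
(`escape_sleepAt_le`). Hence upper bounds for `escape` may be computed along a strategy of one's
choice, in which particles may be kept awake. Particles in disjoint regions can be treated separately
(`escape_union_le`).

*Few particles do not spread far* (`exists_forall_escape_labelled_le`). For at most `K` particles the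
strategy consists of `K` rounds. In a round each particle first makes `T` steps of a simple random
walk, `T` of order `K ^ 4`; by the local bound `walkStep_pow_single_le` two given particles then are
at a given position relative to each other with probability at most of order `T ^ (-1/2)`, that is
`K ^ (-2)`. After that the particles walk, one after the other, until they fall asleep, which takes
a geometric number of steps. With probability at least one half none of the at most `K ^ 2 / 2`
pairs collides, if the constant in `T` is large, and then all particles sleep. Otherwise all
particles are woken up and the next round begins. All `K` rounds fail with probability at most
`2 ^ (-K)`, and in a total time of order `K ^ 5` no particle gets further than order `K ^ (3 + 1 / d)`,
except with a probability that is exponentially small in `K`; the latter is controlled by the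
exponential weights `coshWeight`.

*Clusters.* Let `K` be the integer part of `L ^ (ε / (4 d))`, so that the density is at most
`K ^ (-4 d)`. A ball of radius `K r`, with `r` a small multiple of `K ^ (3 + 1 / d)`, contains on
average at most a small multiple of `K` particles, and with high probability no such ball contains
`K` particles (`poisson_sum_ge_le`). Then the particles split into clusters of fewer than `K`
particles at mutual distances more than `r` (`exists_isolated_cluster`), each of which stays within
distance `r / 2` of its initial positions. Since `r / 2` is smaller than `L ^ ε`, the boundary is not
reached.
-/

noncomputable section

namespace ARW

/-! ### The value function of the escape problem -/

section EscapeValue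

variable {d : ℕ}

/-- The mean of `f` after one toppling of the site `y`: a toppling is an attempt to sleep with
probability `lam / (lam + 2 d)`, and otherwise a jump to a uniform neighbour. -/
def toppleMean (lam : ℝ) (f : Config d → ℝ) (η : Config d) (y : Site d) : ℝ :=
  (lam * f (sleepAt η y) + ∑ i : Fin d, ∑ s : ℤˣ, f (jumpFromTo η y (y + Pi.single i (s : ℤ)))) /
    (lam + 2 * d)

/-- Nonnegative functions that are at least `1` as soon as a particle is outside `V`, and that do not
increase in mean when a site holding active particles is toppled. -/
structure IsEscapeBound (lam : ℝ) (V : Set (Site d)) (f : Config d → ℝ) : Prop where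
  nonneg : ∀ η, 0 ≤ f η
  one_le : ∀ η, (∃ x, x ∉ V ∧ η x ≠ 0) → 1 ≤ f η
  topple : ∀ η y, (η y).numActive ≠ 0 → toppleMean lam f η y ≤ f η

/-- The least escape bound: the supremum, over all strategies to topple sites with active particles,
of the probability that a particle ever leaves `V`. -/
def escape (lam : ℝ) (V : Set (Site d)) (η : Config d) : ℝ :=
  ⨅ f : {f : Config d → ℝ // IsEscapeBound lam V f}, f.1 η

variable {lam : ℝ} {V : Set (Site d)} {η : Config d} {y z w : Site d}

theorem add_two_mul_pos (hlam : 0 < lam) : 0 < lam + 2 * (d : ℝ) := by positivity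

theorem toppleMean_mono (hlam : 0 < lam) {f g : Config d → ℝ} {ξ : Config d}
    (hs : f (sleepAt η y) ≤ g (sleepAt ξ z))
    (hj : ∀ i : Fin d, ∀ s : ℤˣ, f (jumpFromTo η y (y + Pi.single i (s : ℤ))) ≤
      g (jumpFromTo ξ z (z + Pi.single i (s : ℤ)))) :
    toppleMean lam f η y ≤ toppleMean lam g ξ z := by
  unfold toppleMean
  gcongr with i _ s _
  exact hj i s

theorem toppleMean_const (hlam : 0 < lam) (c : ℝ) {η : Config d} {y : Site d} :
    toppleMean lam (fun _ => c) η y = c := by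
  have := add_two_mul_pos (d := d) hlam
  unfold toppleMean
  rw [div_eq_iff this.ne']
  simp
  ring

theorem toppleMean_add_const (hlam : 0 < lam) (f : Config d → ℝ) (c : ℝ) :
    toppleMean lam (fun ξ => f ξ + c) η y = toppleMean lam f η y + c := by
  have := add_two_mul_pos (d := d) hlam
  unfold toppleMean
  rw [div_add' _ _ _ this.ne']
  congr 1
  simp [Finset.sum_add_distrib]
  ring

theorem toppleMean_nonneg (hlam : 0 < lam) {f : Config d → ℝ} (hf : ∀ ξ, 0 ≤ f ξ) :
    0 ≤ toppleMean lam f η y := by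
  unfold toppleMean
  have h1 : 0 ≤ lam * f (sleepAt η y) := mul_nonneg hlam.le (hf _)
  have h2 : 0 ≤ ∑ i : Fin d, ∑ s : ℤˣ, f (jumpFromTo η y (y + Pi.single i (s : ℤ))) :=
    Finset.sum_nonneg fun _ _ => Finset.sum_nonneg fun _ _ => hf _
  positivity

theorem isEscapeBound_one (hlam : 0 < lam) : IsEscapeBound lam V (fun _ => 1) where
  nonneg _ := zero_le_one
  one_le _ _ := le_rfl
  topple _ _ _ := (toppleMean_const hlam 1).le

theorem bddBelow_escape (η : Config d) :
    BddBelow (Set.range fun f : {f : Config d → ℝ // IsEscapeBound lam V f} => f.1 η) :=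
  ⟨0, by rintro _ ⟨f, rfl⟩; exact f.2.nonneg η⟩

theorem escape_le {f : Config d → ℝ} (hf : IsEscapeBound lam V f) (η : Config d) :
    escape lam V η ≤ f η :=
  ciInf_le (bddBelow_escape η) (⟨f, hf⟩ : {f : Config d → ℝ // IsEscapeBound lam V f})

theorem le_escape (hlam : 0 < lam) {c : ℝ}
    (h : ∀ f : Config d → ℝ, IsEscapeBound lam V f → c ≤ f η) : c ≤ escape lam V η := by
  have : Nonempty {f : Config d → ℝ // IsEscapeBound lam V f} := ⟨⟨_, isEscapeBound_one hlam⟩⟩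
  exact le_ciInf fun f => h f.1 f.2

theorem isEscapeBound_escape (hlam : 0 < lam) : IsEscapeBound lam V (escape lam V) where
  nonneg η := le_escape hlam fun _ hf => hf.nonneg η
  one_le η h := le_escape hlam fun _ hf => hf.one_le η h
  topple η y hy := le_escape hlam fun _ hf =>
    (toppleMean_mono hlam (escape_le hf _) fun _ _ => escape_le hf _).trans (hf.topple η y hy)

theorem escape_nonneg (hlam : 0 < lam) : 0 ≤ escape lam V η :=
  (isEscapeBound_escape hlam).nonneg η

theorem escape_le_one (hlam : 0 < lam) : escape lam V η ≤ 1 :=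
  escape_le (isEscapeBound_one hlam) η

theorem escape_eq_one (hlam : 0 < lam) (h : ∃ x, x ∉ V ∧ η x ≠ 0) : escape lam V η = 1 :=
  (escape_le_one hlam).antisymm ((isEscapeBound_escape hlam).one_le η h)

theorem escape_anti (hlam : 0 < lam) {V' : Set (Site d)} (h : V ⊆ V') :
    escape lam V' η ≤ escape lam V η :=
  escape_le ⟨fun _ => escape_nonneg hlam,
    fun _ ⟨x, hx, hx'⟩ => (isEscapeBound_escape hlam).one_le _ ⟨x, fun hxV => hx (h hxV), hx'⟩,
    fun _ _ => (isEscapeBound_escape hlam).topple _ _⟩ η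

theorem escape_eq_zero (hlam : 0 < lam) (hV : ∀ x, x ∉ V → η x = 0)
    (hη : ∀ x, (η x).numActive = 0) : escape lam V η = 0 := by
  classical
  refine le_antisymm ?_ (escape_nonneg hlam)
  let f : Config d → ℝ := fun ξ => if ξ = η then 0 else 1
  have hf1 : ∀ ξ, f ξ ≤ 1 := fun ξ => by dsimp only [f]; split_ifs <;> norm_num
  have hf : IsEscapeBound lam V f := by
    refine ⟨fun ξ => by dsimp only [f]; split_ifs <;> norm_num, ?_, ?_⟩
    · rintro ξ ⟨x, hx, hx'⟩
      have : ξ ≠ η := by rintro rfl; exact hx' (hV x hx)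
      simp [f, this]
    · intro ξ y hy
      have : ξ ≠ η := by rintro rfl; exact hy (hη y)
      calc toppleMean lam f ξ y ≤ toppleMean lam (fun _ => 1) ξ y :=
            toppleMean_mono hlam (hf1 _) fun _ _ => hf1 _
        _ = f ξ := by rw [toppleMean_const hlam]; simp [f, this]
  exact (escape_le hf η).trans (by simp [f])

end EscapeValue

/-! ### Commutation of topplings -/

section Commutation

variable {d : ℕ} {lam : ℝ} {V : Set (Site d)} {η : Config d} {y z w : Site d}

open SiteState

theorem SiteState.addOne_ne_zero (s : SiteState) : s.addOne ≠ 0 := by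
  cases s <;> intro h <;> injection h <;> omega

theorem sleepAt_apply (η : Config d) (y x : Site d) :
    sleepAt η y x = if x = y then (η y).trySleep else η x := by
  classical
  simp only [sleepAt, Finsupp.update_apply]

theorem jumpFromTo_of_active (hy : (η y).numActive ≠ 0) (z x : Site d) :
    jumpFromTo η y z x =
      if x = z then (η z).addOne else if x = y then (η y).removeOne else η x := by
  classical
  simp only [jumpFromTo, hy, if_false, Finsupp.update_apply]

/-- The state after a possible sleeping particle has been woken up. -/
def SiteState.wake : SiteState → SiteState
  | sleeping => active 1
  | active n => active n

/-- The configuration in which a possible sleeping particle at `y` has been woken up. -/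
def wakeAt (η : Config d) (y : Site d) : Config d :=
  η.update y (η y).wake

theorem wakeAt_apply (η : Config d) (y x : Site d) :
    wakeAt η y x = if x = y then (η y).wake else η x := by
  classical
  simp only [wakeAt, Finsupp.update_apply]

theorem active_sleepAt_iff (h : z ≠ y) :
    ((sleepAt η y) z).numActive ≠ 0 ↔ (η z).numActive ≠ 0 := by
  rw [sleepAt_apply, if_neg h]

theorem active_jumpFromTo (hy : (η y).numActive ≠ 0) (h : z ≠ y) (hz : (η z).numActive ≠ 0) :
    ((jumpFromTo η y w) z).numActive ≠ 0 := by
  rw [jumpFromTo_of_active hy]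
  split_ifs with h1
  · subst h1
    cases hs : η z <;> simp [addOne, numActive]
  · exact hz

theorem sleepAt_sleepAt_comm (h : y ≠ z) :
    sleepAt (sleepAt η y) z = sleepAt (sleepAt η z) y := by
  ext x
  simp only [sleepAt_apply]
  grind

theorem trySleep_addOne (s : SiteState) (hs : s.numActive ≠ 0) :
    s.addOne.trySleep = s.trySleep.addOne := by
  cases s with
  | sleeping => simp [numActive] at hs
  | active n =>
    simp only [numActive] at hs
    simp only [addOne, trySleep]
    split_ifs <;> grind

theorem addOne_removeOne (s : SiteState) (hs : s.numActive ≠ 0) :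
    s.addOne.removeOne = s.removeOne.addOne := by
  cases s with
  | sleeping => simp [numActive] at hs
  | active n =>
    simp only [numActive] at hs
    simp only [addOne, removeOne]
    grind

theorem sleepAt_jumpFromTo_comm (h : y ≠ z) (hy : (η y).numActive ≠ 0)
    (hz : (η z).numActive ≠ 0) :
    sleepAt (jumpFromTo η z w) y = jumpFromTo (sleepAt η y) z w := by
  have hz' := (active_sleepAt_iff (η := η) h.symm).2 hz
  have := trySleep_addOne _ hy
  ext x
  simp only [sleepAt_apply, jumpFromTo_of_active hz, jumpFromTo_of_active hz']
  grind

theorem jumpFromTo_jumpFromTo_comm {v : Site d} (h : y ≠ z) (hy : (η y).numActive ≠ 0)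
    (hz : (η z).numActive ≠ 0) (hv : v ≠ y) (hw : w ≠ z) :
    jumpFromTo (jumpFromTo η z w) y v = jumpFromTo (jumpFromTo η y v) z w := by
  have hz' := active_jumpFromTo (w := v) hy h.symm hz
  have hy' := active_jumpFromTo (w := w) hz h hy
  have e1 := addOne_removeOne _ hy
  have e2 := addOne_removeOne _ hz
  ext x
  simp only [jumpFromTo_of_active hz, jumpFromTo_of_active hy, jumpFromTo_of_active hz',
    jumpFromTo_of_active hy']
  grind

theorem add_single_unit_ne (y : Site d) (i : Fin d) (s : ℤˣ) :
    y + Pi.single i (s : ℤ) ≠ y := by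
  intro h
  have := congrFun h i
  simp at this

theorem wakeAt_sleepAt_comm (h : y ≠ z) :
    wakeAt (sleepAt η z) y = sleepAt (wakeAt η y) z := by
  ext x
  simp only [sleepAt_apply, wakeAt_apply]
  grind

theorem wakeAt_jumpFromTo_comm (h : y ≠ z) (hz : (η z).numActive ≠ 0) :
    wakeAt (jumpFromTo η z w) y = jumpFromTo (wakeAt η y) z w := by
  have hz' : ((wakeAt η y) z).numActive ≠ 0 := by rwa [wakeAt_apply, if_neg h.symm]
  have key : ∀ s : SiteState, s.addOne.wake = s.wake.addOne := fun s => by cases s <;> rfl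
  ext x
  simp only [wakeAt_apply, jumpFromTo_of_active hz, jumpFromTo_of_active hz']
  grind

theorem sum_sum_sum_sum_comm {ι κ : Type*} [Fintype ι] [Fintype κ] (G : ι → κ → ι → κ → ℝ) :
    ∑ i, ∑ s, ∑ j, ∑ t, G i s j t = ∑ j, ∑ t, ∑ i, ∑ s, G i s j t := by
  calc ∑ i, ∑ s, ∑ j, ∑ t, G i s j t
      = ∑ a : ι × κ, ∑ b : ι × κ, G a.1 a.2 b.1 b.2 := by simp only [Fintype.sum_prod_type]
    _ = ∑ b : ι × κ, ∑ a : ι × κ, G a.1 a.2 b.1 b.2 := Finset.sum_comm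
    _ = _ := by simp only [Fintype.sum_prod_type]

theorem toppleMean_comm (h : y ≠ z) (hy : (η y).numActive ≠ 0)
    (hz : (η z).numActive ≠ 0) (f : Config d → ℝ) :
    toppleMean lam (fun ξ => toppleMean lam f ξ y) η z =
      toppleMean lam (fun ξ => toppleMean lam f ξ z) η y := by
  simp only [toppleMean]
  congr 1
  have e1 : ∀ i : Fin d, ∀ s : ℤˣ, sleepAt (jumpFromTo η z (z + Pi.single i (s : ℤ))) y =
      jumpFromTo (sleepAt η y) z (z + Pi.single i (s : ℤ)) := fun i s =>
    sleepAt_jumpFromTo_comm h hy hz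
  have e2 : ∀ i : Fin d, ∀ s : ℤˣ, sleepAt (jumpFromTo η y (y + Pi.single i (s : ℤ))) z =
      jumpFromTo (sleepAt η z) y (y + Pi.single i (s : ℤ)) := fun i s =>
    sleepAt_jumpFromTo_comm h.symm hz hy
  have e3 : ∀ i : Fin d, ∀ s : ℤˣ, ∀ j : Fin d, ∀ t : ℤˣ,
      jumpFromTo (jumpFromTo η z (z + Pi.single i (s : ℤ))) y (y + Pi.single j (t : ℤ)) =
      jumpFromTo (jumpFromTo η y (y + Pi.single j (t : ℤ))) z (z + Pi.single i (s : ℤ)) :=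
    fun i s j t => jumpFromTo_jumpFromTo_comm h hy hz (add_single_unit_ne _ _ _)
      (add_single_unit_ne _ _ _)
  simp only [e1, e2, e3, sleepAt_sleepAt_comm h.symm, ← Finset.sum_div, mul_div_assoc',
    ← add_div]
  congr 1
  simp only [Finset.sum_add_distrib, ← Finset.mul_sum, mul_add]
  rw [sum_sum_sum_sum_comm]
  ring

/-- Waking a particle up can only increase the probability to escape. -/
theorem escape_le_escape_wakeAt (hlam : 0 < lam) (η : Config d) (y : Site d) :
    escape lam V η ≤ escape lam V (wakeAt η y) := by
  have H := isEscapeBound_escape (V := V) hlam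
  have hg : IsEscapeBound lam V (fun ξ => min (escape lam V ξ) (escape lam V (wakeAt ξ y))) := by
    refine ⟨fun ξ => le_min (H.nonneg _) (H.nonneg _), ?_, ?_⟩
    · rintro ξ ⟨x, hx, hx'⟩
      refine le_min (H.one_le _ ⟨x, hx, hx'⟩) (H.one_le _ ⟨x, hx, ?_⟩)
      rw [wakeAt_apply]
      split_ifs with h1
      · subst h1
        cases hs : ξ x with
        | sleeping => intro h; injection h; omega
        | active n => rwa [hs] at hx'
      · exact hx'
    · intro ξ z hz
      have h1 : toppleMean lam (fun ξ => min (escape lam V ξ) (escape lam V (wakeAt ξ y))) ξ z ≤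
          escape lam V ξ := (toppleMean_mono hlam (g := escape lam V) (min_le_left _ _)
            fun _ _ => min_le_left _ _).trans (H.topple ξ z hz)
      refine le_min h1 ?_
      by_cases h : y = z
      · subst h
        have : wakeAt ξ y = ξ := by
          ext x
          rw [wakeAt_apply]
          have : (ξ y).wake = ξ y := by
            cases hs : ξ y with
            | sleeping => simp [hs, numActive] at hz
            | active n => rfl
          grind
        rwa [this]
      · have hz' : ((wakeAt ξ y) z).numActive ≠ 0 := by rwa [wakeAt_apply, if_neg (Ne.symm h)]
        refine (toppleMean_mono hlam (g := escape lam V) ?_ fun i s => ?_).trans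
          (H.topple (wakeAt ξ y) z hz')
        · rw [← wakeAt_sleepAt_comm h]; exact min_le_right _ _
        · rw [← wakeAt_jumpFromTo_comm h hz]; exact min_le_right _ _
  exact (escape_le hg η).trans (min_le_right _ _)

theorem escape_sleepAt_le (hlam : 0 < lam) (η : Config d) (y : Site d) :
    escape lam V (sleepAt η y) ≤ escape lam V η := by
  by_cases h : η y = active 1
  · have : wakeAt (sleepAt η y) y = η := by
      ext x
      rw [wakeAt_apply, sleepAt_apply, sleepAt_apply]
      have : (active 1).trySleep.wake = active 1 := rfl
      grind
    calc _ ≤ _ := escape_le_escape_wakeAt hlam _ y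
      _ = _ := by rw [this]
  · have : sleepAt η y = η := by
      ext x
      rw [sleepAt_apply]
      split_ifs with hx
      · subst hx
        cases hs : η x with
        | sleeping => rfl
        | active n => simp only [trySleep]; grind
      · rfl
    rw [this]

/-- The abelian property: toppling first a given site that holds active particles is an optimal
strategy. Indeed the order of the topplings is irrelevant, and this site has to be toppled anyway. -/
theorem escape_le_toppleMean (hlam : 0 < lam) (hyV : y ∈ V) (hy : (η y).numActive ≠ 0) :
    escape lam V η ≤ toppleMean lam (escape lam V) η y := by
  classical
  have H := isEscapeBound_escape (V := V) hlam
  let g : Config d → ℝ := fun ξ => if (ξ y).numActive = 0 then escape lam V ξ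
    else min (escape lam V ξ) (toppleMean lam (escape lam V) ξ y)
  have hgl : ∀ ξ, g ξ ≤ escape lam V ξ := fun ξ => by
    dsimp only [g]; split_ifs
    · exact le_rfl
    · exact min_le_left _ _
  have hgr : ∀ ξ, (ξ y).numActive ≠ 0 → g ξ ≤ toppleMean lam (escape lam V) ξ y := fun ξ h => by
    dsimp only [g]; rw [if_neg h]
    exact min_le_right _ _
  have hg : IsEscapeBound lam V g := by
    refine ⟨fun ξ => ?_, ?_, ?_⟩
    · dsimp only [g]; split_ifs
      · exact H.nonneg _
      · exact le_min (H.nonneg _) (toppleMean_nonneg hlam H.nonneg)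
    · rintro ξ ⟨x, hx, hx'⟩
      dsimp only [g]; split_ifs with hξ
      · exact H.one_le _ ⟨x, hx, hx'⟩
      · refine le_min (H.one_le _ ⟨x, hx, hx'⟩) ?_
        have hxy : x ≠ y := by rintro rfl; exact hx hyV
        rw [← toppleMean_const (η := ξ) (y := y) hlam 1]
        refine toppleMean_mono hlam (H.one_le _ ⟨x, hx, ?_⟩) fun i s => H.one_le _ ⟨x, hx, ?_⟩
        · rwa [sleepAt_apply, if_neg hxy]
        · rw [jumpFromTo_of_active hξ, if_neg hxy]
          split_ifs
          · exact SiteState.addOne_ne_zero _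
          · exact hx'
    · intro ξ z hz
      have h1 : toppleMean lam g ξ z ≤ escape lam V ξ :=
        (toppleMean_mono hlam (g := escape lam V) (hgl _) fun _ _ => hgl _).trans (H.topple ξ z hz)
      by_cases hξ : (ξ y).numActive = 0
      · simpa only [g, if_pos hξ] using h1
      · have : g ξ = min (escape lam V ξ) (toppleMean lam (escape lam V) ξ y) := by
          simp only [g, if_neg hξ]
        rw [this]
        refine le_min h1 ?_
        by_cases h : y = z
        · subst h
          exact toppleMean_mono hlam (hgl _) fun _ _ => hgl _
        · calc toppleMean lam g ξ z
              ≤ toppleMean lam (fun ξ => toppleMean lam (escape lam V) ξ y) ξ z := by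
                refine toppleMean_mono hlam (hgr _ ?_) fun i s => hgr _ ?_
                · exact (active_sleepAt_iff h).2 hξ
                · exact active_jumpFromTo hz h hξ
            _ = toppleMean lam (fun ξ => toppleMean lam (escape lam V) ξ z) ξ y :=
                toppleMean_comm h hξ hz _
            _ ≤ toppleMean lam (escape lam V) ξ y := by
                refine toppleMean_mono hlam (H.topple _ _ ?_) fun i s => H.topple _ _ ?_
                · exact (active_sleepAt_iff (Ne.symm h)).2 hz
                · exact active_jumpFromTo hξ (Ne.symm h) hz
  exact (escape_le hg η).trans (hgr η hy)

end Commutation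

/-! ### Particles in disjoint regions -/

section Restriction

variable {d : ℕ} {lam : ℝ} {V W : Set (Site d)} {η : Config d} {y z : Site d}

open Classical in
/-- The configuration of the particles in `V`. -/
def restrictTo (V : Set (Site d)) (η : Config d) : Config d := η.filter (· ∈ V)

theorem restrictTo_of_mem (h : y ∈ V) : restrictTo V η y = η y := by
  classical
  simp [restrictTo, h]

theorem restrictTo_of_notMem (h : y ∉ V) : restrictTo V η y = 0 := by
  classical
  simp [restrictTo, h]

theorem restrictTo_sleepAt (h : y ∈ V) :
    restrictTo V (sleepAt η y) = sleepAt (restrictTo V η) y := by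
  ext x
  rw [sleepAt_apply, restrictTo_of_mem h]
  by_cases hx : x ∈ V
  · rw [restrictTo_of_mem hx, restrictTo_of_mem hx, sleepAt_apply]
  · rw [restrictTo_of_notMem hx, restrictTo_of_notMem hx, if_neg (by rintro rfl; exact hx h)]

theorem restrictTo_sleepAt_of_notMem (h : y ∉ V) :
    restrictTo V (sleepAt η y) = restrictTo V η := by
  ext x
  by_cases hx : x ∈ V
  · rw [restrictTo_of_mem hx, restrictTo_of_mem hx, sleepAt_apply,
      if_neg (by rintro rfl; exact h hx)]
  · rw [restrictTo_of_notMem hx, restrictTo_of_notMem hx]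

theorem restrictTo_jumpFromTo (hy : (η y).numActive ≠ 0) (h : y ∈ V) (hz : z ∈ V) :
    restrictTo V (jumpFromTo η y z) = jumpFromTo (restrictTo V η) y z := by
  have hy' : ((restrictTo V η) y).numActive ≠ 0 := by rwa [restrictTo_of_mem h]
  ext x
  rw [jumpFromTo_of_active hy', restrictTo_of_mem h, restrictTo_of_mem hz]
  by_cases hx : x ∈ V
  · rw [restrictTo_of_mem hx, restrictTo_of_mem hx, jumpFromTo_of_active hy]
  · rw [restrictTo_of_notMem hx, restrictTo_of_notMem hx, if_neg (by rintro rfl; exact hx hz),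
      if_neg (by rintro rfl; exact hx h)]

theorem restrictTo_jumpFromTo_of_notMem (hy : (η y).numActive ≠ 0) (h : y ∉ V) (hz : z ∉ V) :
    restrictTo V (jumpFromTo η y z) = restrictTo V η := by
  ext x
  by_cases hx : x ∈ V
  · rw [restrictTo_of_mem hx, restrictTo_of_mem hx, jumpFromTo_of_active hy,
      if_neg (by rintro rfl; exact hz hx), if_neg (by rintro rfl; exact h hx)]
  · rw [restrictTo_of_notMem hx, restrictTo_of_notMem hx]

theorem toppleMean_restrictTo_le (hlam : 0 < lam) (hVW : Disjoint V W) {f : Config d → ℝ}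
    (hf1 : ∀ ξ, f ξ ≤ 1)
    (hf : ∀ ξ, (∀ x, ξ x ≠ 0 → x ∈ V ∪ W) →
      f ξ ≤ escape lam V (restrictTo V ξ) + escape lam W (restrictTo W ξ))
    (hη : ∀ x, η x ≠ 0 → x ∈ V ∪ W) (hyV : y ∈ V) (hy : (η y).numActive ≠ 0) :
    toppleMean lam f η y ≤ escape lam V (restrictTo V η) + escape lam W (restrictTo W η) := by
  have H := isEscapeBound_escape (V := V) hlam
  have hyW : y ∉ W := hVW.notMem_of_mem_left hyV
  have hy' : ((restrictTo V η) y).numActive ≠ 0 := by rwa [restrictTo_of_mem hyV]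
  calc toppleMean lam f η y
      ≤ toppleMean lam (fun ξ => escape lam V ξ + escape lam W (restrictTo W η))
          (restrictTo V η) y := by
        refine toppleMean_mono hlam ?_ fun i s => ?_
        · refine (hf _ fun x hx => hη x fun h => hx ?_).trans_eq ?_
          · rw [sleepAt_apply]
            split_ifs with hxy
            · subst hxy; simp [h, SiteState.numActive] at hy
            · exact h
          · rw [restrictTo_sleepAt hyV, restrictTo_sleepAt_of_notMem hyW]
        · set z := y + Pi.single i (s : ℤ) with hz
          by_cases hzV : z ∈ V
          · refine (hf _ fun x hx => ?_).trans_eq ?_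
            · rw [jumpFromTo_of_active hy] at hx
              split_ifs at hx with h1 h2
              · exact Or.inl (h1 ▸ hzV)
              · exact Or.inl (h2 ▸ hyV)
              · exact hη x hx
            · rw [restrictTo_jumpFromTo hy hyV hzV,
                restrictTo_jumpFromTo_of_notMem hy hyW (hVW.notMem_of_mem_left hzV)]
          · rw [escape_eq_one (η := jumpFromTo _ _ _) hlam ⟨z, hzV, ?_⟩]
            · linarith [hf1 (jumpFromTo η y z), escape_nonneg (V := W) (η := restrictTo W η) hlam]
            · rw [jumpFromTo_of_active hy', if_pos rfl]
              exact SiteState.addOne_ne_zero _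
    _ = toppleMean lam (escape lam V) (restrictTo V η) y + escape lam W (restrictTo W η) :=
        toppleMean_add_const hlam _ _
    _ ≤ _ := by gcongr; exact H.topple _ _ hy'

/-- As long as no particle leaves its region, the particles in disjoint regions do not interact. -/
theorem escape_union_le (hlam : 0 < lam) (hVW : Disjoint V W)
    (hη : ∀ x, η x ≠ 0 → x ∈ V ∪ W) :
    escape lam (V ∪ W) η ≤
      escape lam V (restrictTo V η) + escape lam W (restrictTo W η) := by
  classical
  let f : Config d → ℝ := fun ξ => if ∀ x, ξ x ≠ 0 → x ∈ V ∪ W then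
    min 1 (escape lam V (restrictTo V ξ) + escape lam W (restrictTo W ξ)) else 1
  have hf1 : ∀ ξ, f ξ ≤ 1 := fun ξ => by
    dsimp only [f]; split_ifs
    · exact min_le_left _ _
    · exact le_rfl
  have hf2 : ∀ ξ, (∀ x, ξ x ≠ 0 → x ∈ V ∪ W) →
      f ξ ≤ escape lam V (restrictTo V ξ) + escape lam W (restrictTo W ξ) := fun ξ h => by
    dsimp only [f]; rw [if_pos h]
    exact min_le_right _ _
  have hf : IsEscapeBound lam (V ∪ W) f := by
    refine ⟨fun ξ => ?_, ?_, ?_⟩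
    · dsimp only [f]; split_ifs
      · exact le_min zero_le_one (add_nonneg (escape_nonneg hlam) (escape_nonneg hlam))
      · exact zero_le_one
    · rintro ξ ⟨x, hx, hx'⟩
      dsimp only [f]; rw [if_neg fun h => hx (h x hx')]
    · intro ξ y hy
      have h1 : toppleMean lam f ξ y ≤ 1 :=
        (toppleMean_mono hlam (g := fun _ => 1) (hf1 _) fun _ _ => hf1 _).trans_eq
          (toppleMean_const (η := ξ) (y := y) hlam 1)
      by_cases hξ : ∀ x, ξ x ≠ 0 → x ∈ V ∪ W
      · have : f ξ = min 1 (escape lam V (restrictTo V ξ) + escape lam W (restrictTo W ξ)) :=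
          if_pos hξ
        rw [this]
        refine le_min h1 ?_
        have hy0 : ξ y ≠ 0 := by rintro h; rw [h] at hy; exact hy rfl
        rcases hξ y hy0 with hyV | hyW
        · exact toppleMean_restrictTo_le hlam hVW hf1 hf2 hξ hyV hy
        · rw [add_comm]
          refine toppleMean_restrictTo_le hlam hVW.symm hf1 (fun ζ hζ => ?_) (fun x hx => ?_) hyW hy
          · rw [add_comm]; exact hf2 ζ fun x hx => (hζ x hx).symm
          · exact (hξ x hx).symm
      · have : f ξ = 1 := if_neg hξ
        rwa [this]
  exact (escape_le hf η).trans (hf2 η hη)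

end Restriction

/-! ### The jump chain -/

section Chain

variable {d : ℕ} {lam : ℝ} {V : Set (Site d)}

theorem lintegral_rates (f : Config d → ℝ≥0∞) (η : Config d) :
    ∫⁻ ξ, f ξ ∂(rates lam η) = ∑ y ∈ η.support,
      ((if (η y).numActive = 1 then ENNReal.ofReal lam else 0) * f (sleepAt η y) +
        ∑ i : Fin d, ∑ s : ℤˣ,
          ((η y).numActive : ℝ≥0∞) * f (jumpFromTo η y (y + Pi.single i (s : ℤ)))) := by
  simp only [rates, lintegral_finsetSum_measure, lintegral_add_measure, lintegral_smul_measure,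
    lintegral_dirac, smul_eq_mul]

theorem sleepAt_eq_self {η : Config d} {y : Site d} (h : (η y).numActive ≠ 1) :
    sleepAt η y = η := by
  ext x
  rw [sleepAt_apply]
  split_ifs with hx
  · subst hx
    cases hs : η x with
    | sleeping => rfl
    | active n =>
      rw [hs] at h
      exact if_neg h
  · rfl

/-- An escape bound does not increase in mean along a step of the jump chain. -/
theorem lintegral_rates_le (hlam : 0 < lam) {f : Config d → ℝ} (hf : IsEscapeBound lam V f)
    (η : Config d) :
    ∫⁻ ξ, ENNReal.ofReal (f ξ) ∂(rates lam η) ≤ totalRate lam η * ENNReal.ofReal (f η) := by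
  have h1 : totalRate lam η = ∫⁻ _, 1 ∂(rates lam η) := by simp [totalRate]
  rw [h1, lintegral_rates, lintegral_rates, Finset.sum_mul]
  refine Finset.sum_le_sum fun y _ => ?_
  by_cases hy : (η y).numActive = 0
  · simp [hy]
  have hpos := add_two_mul_pos (d := d) hlam
  have ht := hf.topple η y hy
  rw [toppleMean, div_le_iff₀ hpos] at ht
  have hn : ∀ ξ, 0 ≤ f ξ := hf.nonneg
  have hsum : ∑ i : Fin d, ∑ s : ℤˣ, ENNReal.ofReal (f (jumpFromTo η y (y + Pi.single i (s : ℤ)))) =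
      ENNReal.ofReal (∑ i : Fin d, ∑ s : ℤˣ, f (jumpFromTo η y (y + Pi.single i (s : ℤ)))) := by
    rw [ENNReal.ofReal_sum_of_nonneg fun _ _ => Finset.sum_nonneg fun _ _ => hn _]
    refine Finset.sum_congr rfl fun i _ => ?_
    rw [ENNReal.ofReal_sum_of_nonneg fun _ _ => hn _]
  set S := ∑ i : Fin d, ∑ s : ℤˣ, f (jumpFromTo η y (y + Pi.single i (s : ℤ))) with hS
  have hS0 : 0 ≤ S := Finset.sum_nonneg fun _ _ => Finset.sum_nonneg fun _ _ => hn _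
  have hone : ∀ c : ℝ≥0∞, ∑ _i : Fin d, ∑ _s : ℤˣ, c = c * ENNReal.ofReal (2 * d) := fun c => by
    rw [mul_comm 2 (d : ℝ), ENNReal.ofReal_mul (by positivity), ENNReal.ofReal_natCast]
    simp
    ring
  simp only [← Finset.mul_sum, hsum, mul_one, hone]
  by_cases h1 : (η y).numActive = 1
  · simp only [h1, if_true, Nat.cast_one, one_mul]
    rw [← ENNReal.ofReal_mul hlam.le,
      ← ENNReal.ofReal_add (mul_nonneg hlam.le (hn _)) hS0]
    rw [← ENNReal.ofReal_add hlam.le (by positivity), ← ENNReal.ofReal_mul hpos.le]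
    exact ENNReal.ofReal_le_ofReal (by linarith)
  · rw [if_neg h1, zero_mul, zero_add, zero_add, mul_assoc]
    refine mul_le_mul_right ?_ _
    rw [← ENNReal.ofReal_mul (by positivity)]
    rw [sleepAt_eq_self h1] at ht
    exact ENNReal.ofReal_le_ofReal (by linarith)

theorem lintegral_jumpKernel_le (hlam : 0 < lam) {f : Config d → ℝ} (hf : IsEscapeBound lam V f)
    (η : Config d) :
    ∫⁻ ξ, ENNReal.ofReal (f ξ) ∂(jumpKernel d lam η) ≤ ENNReal.ofReal (f η) := by
  classical
  change ∫⁻ ξ, ENNReal.ofReal (f ξ) ∂(if totalRate lam η = 0 then Measure.dirac η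
    else (totalRate lam η)⁻¹ • rates lam η) ≤ _
  split_ifs with h
  · rw [lintegral_dirac]
  · rw [lintegral_smul_measure, smul_eq_mul]
    calc _ ≤ (totalRate lam η)⁻¹ * (totalRate lam η * ENNReal.ofReal (f η)) := by
          gcongr; exact lintegral_rates_le hlam hf η
      _ = _ := by
          rw [← mul_assoc, ENNReal.inv_mul_cancel h (measure_ne_top _ _), one_mul]

instance {μ : Measure (Config d)} [IsProbabilityMeasure μ] : IsProbabilityMeasure (jumpChain lam μ) := by
  unfold jumpChain; infer_instance

theorem lintegral_jumpChain_zero {μ : Measure (Config d)} (g : Config d → ℝ≥0∞) :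
    ∫⁻ Y, g (Y 0) ∂(jumpChain lam μ) = ∫⁻ η, g η ∂μ := by
  have hg : Measurable g := Measurable.of_discrete
  have hg0 : Measurable fun h : (i : Finset.Iic 0) → Config d => g (h ⟨0, by simp⟩) := by fun_prop
  have h1 : ∀ Y : ℕ → Config d, g (Y 0) =
      (fun h : (i : Finset.Iic 0) → Config d => g (h ⟨0, by simp⟩)) (Preorder.frestrictLe 0 Y) :=
    fun Y => rfl
  simp_rw [h1]
  rw [← lintegral_map (f := fun h : (i : Finset.Iic 0) → Config d => g (h ⟨0, by simp⟩)) hg0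
    (Preorder.measurable_frestrictLe 0), jumpChain, Kernel.trajMeasure,
    Measure.map_comp _ _ (by fun_prop), Kernel.traj_map_frestrictLe, Kernel.partialTraj_self,
    Measure.id_comp, lintegral_map hg0 (by fun_prop)]
  rfl

variable {μ : Measure (Config d)} [IsProbabilityMeasure μ]

/-- The Markov property of the jump chain, tested on nonnegative functions. -/
theorem lintegral_jumpChain_succ (n : ℕ) {F : ((i : Finset.Iic n) → Config d) × Config d → ℝ≥0∞}
    (hF : Measurable F) :
    ∫⁻ Y, F (Preorder.frestrictLe n Y, Y (n + 1)) ∂(jumpChain lam μ) =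
      ∫⁻ Y, ∫⁻ ξ, F (Preorder.frestrictLe n Y, ξ) ∂(jumpKernel d lam (Y n))
        ∂(jumpChain lam μ) := by
  rw [← lintegral_map (f := F) (g := fun Y : ℕ → Config d => (Preorder.frestrictLe n Y, Y (n + 1)))
    hF (by fun_prop), jumpChain,
    ← Kernel.map_frestrictLe_trajMeasure_compProd_eq_map_trajMeasure,
    Measure.lintegral_compProd hF, lintegral_map _ (Preorder.measurable_frestrictLe n)]
  · rfl
  · exact hF.lintegral_kernel_prod_right'

/-- The maximal inequality for the supermartingale given by an escape bound along the jump chain. -/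
theorem jumpChain_exists_le (hlam : 0 < lam) {f : Config d → ℝ} (hf : IsEscapeBound lam V f) :
    jumpChain lam μ {Y | ∃ n, ∃ x, x ∉ V ∧ Y n x ≠ 0} ≤ ∫⁻ η, ENNReal.ofReal (f η) ∂μ := by
  classical
  let B : Set (Config d) := {η | ∃ x, x ∉ V ∧ η x ≠ 0}
  let g : Config d → ℝ≥0∞ := fun η => ENNReal.ofReal (f η)
  have hg : Measurable g := Measurable.of_discrete
  have hB : ∀ η ∈ B, 1 ≤ g η := fun η hη => by
    simpa [g] using hf.one_le η hη
  let A : ℕ → Set (ℕ → Config d) := fun n => {Y | ∃ k ≤ n, Y k ∈ B}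
  have hAm : ∀ n, MeasurableSet (A n) := fun n => by
    have : A n = ⋃ k ∈ Set.Iic n, (fun Y : ℕ → Config d => Y k) ⁻¹' B := by
      ext Y; simp [A]
    rw [this]
    exact MeasurableSet.biUnion (Set.to_countable _) fun k _ =>
      measurable_pi_apply k (MeasurableSet.of_discrete)
  let G : ℕ → (ℕ → Config d) → ℝ≥0∞ := fun n Y => if Y ∈ A n then 1 else g (Y n)
  have hG : ∀ n, ∫⁻ Y, G n Y ∂(jumpChain lam μ) ≤ ∫⁻ η, g η ∂μ := by
    intro n
    induction n with
    | zero =>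
      rw [← lintegral_jumpChain_zero (lam := lam)]
      refine lintegral_mono fun Y => ?_
      dsimp only [G]; split_ifs with h
      · obtain ⟨k, hk, hkB⟩ := h
        rw [Nat.le_zero.1 hk] at hkB
        exact hB _ hkB
      · exact le_rfl
    | succ n ih =>
      refine le_trans ?_ ih
      let D : Set ((i : Finset.Iic n) → Config d) := {h | ∃ k, h k ∈ B}
      have hD : MeasurableSet D := by
        have : D = ⋃ k, (fun h : (i : Finset.Iic n) → Config d => h k) ⁻¹' B := by
          ext Y; simp [D]
        rw [this]
        exact MeasurableSet.iUnion fun k => measurable_pi_apply k (MeasurableSet.of_discrete)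
      have hDA : ∀ Y : ℕ → Config d, Preorder.frestrictLe n Y ∈ D ↔ Y ∈ A n := fun Y =>
        ⟨fun ⟨k, hk⟩ => ⟨k.1, Finset.mem_Iic.1 k.2, hk⟩,
          fun ⟨k, hk, hkB⟩ => ⟨⟨k, Finset.mem_Iic.2 hk⟩, hkB⟩⟩
      let F : ((i : Finset.Iic n) → Config d) × Config d → ℝ≥0∞ :=
        fun p => if p.1 ∈ D then 1 else g p.2
      have hF : Measurable F := Measurable.ite (measurable_fst hD) measurable_const
        (hg.comp measurable_snd)
      calc ∫⁻ Y, G (n + 1) Y ∂(jumpChain lam μ)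
          ≤ ∫⁻ Y, F (Preorder.frestrictLe n Y, Y (n + 1)) ∂(jumpChain lam μ) := by
            refine lintegral_mono fun Y => ?_
            simp only [G, F, hDA]
            by_cases h : Y ∈ A n
            · rw [if_pos h]; split_ifs
              · exact le_rfl
              · next h' => exact absurd (h.imp fun k hk => ⟨hk.1.trans n.le_succ, hk.2⟩) h'
            · rw [if_neg h]; split_ifs with h'
              · obtain ⟨k, hk, hkB⟩ := h'
                rcases hk.lt_or_eq with hlt | rfl
                · exact absurd ⟨k, Nat.lt_succ_iff.1 hlt, hkB⟩ h
                · exact hB _ hkB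
              · exact le_rfl
        _ = _ := lintegral_jumpChain_succ n hF
        _ ≤ ∫⁻ Y, G n Y ∂(jumpChain lam μ) := by
            refine lintegral_mono fun Y => ?_
            simp only [G, F, hDA]
            split_ifs
            · simp
            · exact lintegral_jumpKernel_le hlam hf (Y n)
  have hA1 : ∀ n, jumpChain lam μ (A n) ≤ ∫⁻ η, g η ∂μ := fun n => by
    refine le_trans ?_ (hG n)
    rw [← lintegral_indicator_one (hAm n)]
    refine lintegral_mono fun Y => ?_
    dsimp only [G]
    by_cases h : Y ∈ A n <;> simp [h]
  have hmono : Monotone A := fun m n hmn Y ⟨k, hk, hkB⟩ => ⟨k, hk.trans hmn, hkB⟩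
  have hU : {Y : ℕ → Config d | ∃ n, ∃ x, x ∉ V ∧ Y n x ≠ 0} = ⋃ n, A n := by
    ext Y
    simp only [Set.mem_iUnion]
    exact ⟨fun ⟨n, hn⟩ => ⟨n, n, le_rfl, hn⟩, fun ⟨_, k, _, hk⟩ => ⟨k, hk⟩⟩
  rw [hU, hmono.measure_iUnion]
  exact iSup_le hA1

/-- The probability that the activated random walk ever has a particle outside `V`. -/
theorem law_path_le (hlam : 0 < lam) {S : Set (Site d)} (hS : Disjoint S V) :
    law lam μ {ω | ∃ t : ℝ≥0, ∃ x ∈ S, path lam ω t x ≠ 0} ≤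
      ∫⁻ η, ENNReal.ofReal (escape lam V η) ∂μ := by
  calc law lam μ {ω | ∃ t : ℝ≥0, ∃ x ∈ S, path lam ω t x ≠ 0}
      ≤ law lam μ ({Y | ∃ n, ∃ x, x ∉ V ∧ Y n x ≠ 0} ×ˢ Set.univ) := by
        refine measure_mono ?_
        rintro ω ⟨t, x, hx, h⟩
        exact ⟨⟨_, x, hS.notMem_of_mem_left hx, h⟩, trivial⟩
    _ = jumpChain lam μ {Y | ∃ n, ∃ x, x ∉ V ∧ Y n x ≠ 0} := by
        rw [law, Measure.prod_prod, measure_univ, mul_one]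
    _ ≤ _ := jumpChain_exists_le hlam (isEscapeBound_escape hlam)

end Chain

/-! ### Local bound for the simple random walk -/

section Walk

/-- Translation of functions on the lattice, as a linear operator. -/
def shift {d : ℕ} (u : Site d) : Module.End ℝ (Site d → ℝ) := LinearMap.funLeft ℝ ℝ (· + u)

/-- The transition operator of the simple random walk on `ℤ^d`. -/
def walkStep (d : ℕ) : Module.End ℝ (Site d → ℝ) :=
  (1 / (2 * d) : ℝ) • ∑ i : Fin d, ∑ s : ℤˣ, shift (Pi.single i (s : ℤ))

variable {d : ℕ}

theorem shift_apply (u : Site d) (f : Site d → ℝ) (v : Site d) : shift u f v = f (v + u) := rfl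

theorem shift_mul (u v : Site d) : shift u * shift v = shift (u + v) := by
  ext f x
  simp [shift_apply, add_assoc]

theorem shift_comm (u v : Site d) : Commute (shift u) (shift v) := by
  rw [Commute, SemiconjBy, shift_mul, shift_mul, add_comm]

theorem shift_pow (u : Site d) (n : ℕ) : shift u ^ n = shift (n • u) := by
  induction n with
  | zero => ext f x; simp [shift_apply]
  | succ n ih => rw [pow_succ, ih, shift_mul, succ_nsmul]

theorem walkStep_apply (f : Site d → ℝ) (v : Site d) :
    walkStep d f v = (1 / (2 * d) : ℝ) * ∑ i : Fin d, ∑ s : ℤˣ, f (v + Pi.single i (s : ℤ)) := by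
  simp [walkStep, Finset.sum_apply, shift_apply]

theorem monotone_pow {X : Type*} {A : Module.End ℝ (X → ℝ)} (hA : Monotone A) (n : ℕ) :
    Monotone (A ^ n : Module.End ℝ (X → ℝ)) := by
  rw [Module.End.coe_pow]
  exact hA.iterate n

theorem choose_half_le (n : ℕ) : (n.choose (n / 2) : ℝ) ≤ 2 ^ n / √(n + 1) := by
  have key : ∀ m : ℕ, (2 * m + 1 : ℝ) * (m.centralBinom : ℝ) ^ 2 ≤ 16 ^ m := by
    intro m
    induction m with
    | zero => simp
    | succ m ih =>
      have h : ((m : ℝ) + 1) * (m + 1).centralBinom = 2 * (2 * m + 1) * m.centralBinom := by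
        exact_mod_cast Nat.succ_mul_centralBinom_succ m
      have hm : (0 : ℝ) < ((m : ℝ) + 1) ^ 2 := by positivity
      refine le_of_mul_le_mul_left ?_ hm
      calc ((m : ℝ) + 1) ^ 2 * ((2 * ((m + 1 : ℕ) : ℝ) + 1) * ((m + 1).centralBinom : ℝ) ^ 2)
          = (2 * m + 3) * (((m : ℝ) + 1) * (m + 1).centralBinom) ^ 2 := by push_cast; ring
        _ = (4 * (2 * m + 3) * (2 * m + 1)) * ((2 * m + 1) * (m.centralBinom : ℝ) ^ 2) := by
            rw [h]; ring
        _ ≤ (16 * ((m : ℝ) + 1) ^ 2) * 16 ^ m :=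
            mul_le_mul (by nlinarith) ih (by positivity) (by positivity)
        _ = _ := by ring
  have key2 : ∀ m : ℕ, (m.centralBinom : ℝ) ≤ 4 ^ m / √(2 * m + 1) := by
    intro m
    rw [le_div_iff₀ (by positivity)]
    refine le_of_sq_le_sq ?_ (by positivity)
    rw [mul_pow, Real.sq_sqrt (by positivity), mul_comm, ← pow_mul, mul_comm m 2, pow_mul]
    norm_num [key m]
  obtain ⟨m, rfl | rfl⟩ := n.even_or_odd'
  · have := key2 m
    rw [Nat.centralBinom] at this
    rw [Nat.mul_div_cancel_left _ two_pos, pow_mul]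
    norm_num [this]
  · have h1 : (2 * m + 1) / 2 = m := by omega
    have h2 : (m + 1).centralBinom = 2 * (2 * m + 1).choose m := by
      rw [Nat.centralBinom, show 2 * (m + 1) = 2 * m + 1 + 1 by ring, Nat.choose_succ_succ,
        Nat.choose_symm_half]
      ring
    have h3 := key2 (m + 1)
    rw [h2] at h3
    push_cast at h3 ⊢
    rw [h1]
    have h4 : (4 : ℝ) ^ (m + 1) / √(2 * ((m : ℝ) + 1) + 1) ≤
        2 * (2 ^ (2 * m + 1) / √(2 * m + 1 + 1)) := by
      have : (4 : ℝ) ^ (m + 1) = 2 * 2 ^ (2 * m + 1) := by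
        rw [show (4 : ℝ) = 2 ^ 2 by norm_num, ← pow_mul]; ring
      rw [this, mul_div_assoc]
      gcongr
      linarith
    linarith

/-- One coordinate of the simple random walk: the symmetric walk with steps `± u`. -/
def lineStep (u : Site d) : Module.End ℝ (Site d → ℝ) := (1 / 2 : ℝ) • (shift u + shift (-u))

theorem lineStep_pow_single_le {u : Site d} (hu : u ≠ 0) (n : ℕ) (y v : Site d) :
    (lineStep u ^ n) (Pi.single y 1) v ≤ 1 / √(n + 1) := by
  have h1 : (lineStep u ^ n) (Pi.single y 1) v = (1 / 2) ^ n * ∑ k ∈ Finset.range (n + 1),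
      (Pi.single y (1 : ℝ) : Site d → ℝ) (v + (k • u + (n - k) • (-u))) * (n.choose k : ℝ) := by
    rw [lineStep, smul_pow, (shift_comm u (-u)).add_pow]
    simp only [LinearMap.smul_apply, LinearMap.sum_apply, Pi.smul_apply, Finset.sum_apply,
      smul_eq_mul, shift_pow, shift_mul]
    congr 1
    refine Finset.sum_congr rfl fun k _ => ?_
    rw [← nsmul_eq_mul', LinearMap.smul_apply, Pi.smul_apply, nsmul_eq_mul', shift_apply]
  have h2 : ∑ k ∈ Finset.range (n + 1),
      (Pi.single y (1 : ℝ) : Site d → ℝ) (v + (k • u + (n - k) • (-u))) * (n.choose k : ℝ) ≤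
      n.choose (n / 2) := by
    -- at most one term is nonzero
    by_cases h : ∃ k ∈ Finset.range (n + 1), v + (k • u + (n - k) • (-u)) = y
    · obtain ⟨k, hk, hky⟩ := h
      rw [Finset.sum_eq_single_of_mem k hk]
      · rw [hky, Pi.single_eq_same, one_mul]
        exact_mod_cast Nat.choose_le_middle k n
      · intro l hl hlk
        rw [Pi.single_eq_of_ne, zero_mul]
        intro hly
        have hkl := hky.trans hly.symm
        obtain ⟨i, hi⟩ := Function.ne_iff.1 hu
        have e := congrFun hkl i
        simp only [Pi.add_apply, Pi.smul_apply, Pi.neg_apply] at e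
        have hk' : k ≤ n := Nat.lt_succ_iff.1 (Finset.mem_range.1 hk)
        have hl' : l ≤ n := Nat.lt_succ_iff.1 (Finset.mem_range.1 hl)
        simp only [Pi.zero_apply] at hi
        rw [nsmul_eq_mul, nsmul_eq_mul, nsmul_eq_mul, nsmul_eq_mul, Nat.cast_sub hk',
          Nat.cast_sub hl'] at e
        have e2 : (2 * ((k : ℤ) - l)) * u i = 0 := by linarith
        rcases mul_eq_zero.1 e2 with e3 | e3
        · exact hlk (by omega)
        · exact hi e3
    · push Not at h
      rw [Finset.sum_eq_zero fun k hk => by rw [Pi.single_eq_of_ne (h k hk), zero_mul]]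
      positivity
  rw [h1]
  calc _ ≤ (1 / 2 : ℝ) ^ n * (2 ^ n / √(n + 1)) := by
        gcongr; exact h2.trans (choose_half_le n)
    _ = _ := by rw [mul_div_assoc', ← mul_pow]; norm_num

theorem sum_choose_div_sqrt_le {a b : ℝ} (ha : 0 < a) (hb : 0 ≤ b) (hab : a + b = 1) (T : ℕ) :
    ∑ n ∈ Finset.range (T + 1), a ^ n * b ^ (T - n) * (T.choose n) * (1 / √(n + 1)) ≤
      1 / √(a * (T + 1)) := by
  have h1 : ∑ n ∈ Finset.range (T + 1), a ^ n * b ^ (T - n) * (T.choose n) = 1 := by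
    rw [← add_pow, hab, one_pow]
  have h2 : ∑ n ∈ Finset.range (T + 1), a ^ n * b ^ (T - n) * (T.choose n) * (1 / (n + 1)) ≤
      1 / (a * (T + 1)) := by
    rw [le_div_iff₀ (by positivity), Finset.sum_mul]
    calc ∑ n ∈ Finset.range (T + 1),
          a ^ n * b ^ (T - n) * (T.choose n) * (1 / (n + 1)) * (a * (T + 1))
        = ∑ n ∈ Finset.range (T + 1), a ^ (n + 1) * b ^ (T + 1 - (n + 1)) *
            ((T + 1).choose (n + 1)) := by
          refine Finset.sum_congr rfl fun n _ => ?_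
          have h : ((T : ℝ) + 1) * T.choose n = (T + 1).choose (n + 1) * (n + 1) := by
            exact_mod_cast Nat.add_one_mul_choose_eq T n
          rw [Nat.add_sub_add_right, pow_succ]
          field_simp
          linear_combination b ^ (T - n) * h
      _ ≤ (a + b) ^ (T + 1) := by
          rw [add_pow, Finset.sum_range_succ' _ (T + 1)]
          refine le_add_of_nonneg_right (by positivity)
      _ = 1 := by rw [hab, one_pow]
  set s := √(a * (T + 1)) with hs
  have hs0 : 0 < s := by positivity
  have hs2 : s ^ 2 = a * (T + 1) := Real.sq_sqrt (by positivity)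
  -- `1 / √(n + 1)` is at most the arithmetic mean of `s / (n + 1)` and `1 / s`
  have h3 : ∀ n : ℕ, 1 / √((n : ℝ) + 1) ≤ (s / 2) * (1 / (n + 1)) + 1 / (2 * s) := by
    intro n
    have hn : (0 : ℝ) < √((n : ℝ) + 1) := by positivity
    have hn2 : √((n : ℝ) + 1) ^ 2 = n + 1 := Real.sq_sqrt (by positivity)
    set q := √((n : ℝ) + 1)
    rw [← hn2, ← sub_nonneg]
    have : s / 2 * (1 / q ^ 2) + 1 / (2 * s) - 1 / q = (s - q) ^ 2 / (2 * s * q ^ 2) := by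
      field_simp; ring
    rw [this]; positivity
  calc ∑ n ∈ Finset.range (T + 1), a ^ n * b ^ (T - n) * (T.choose n) * (1 / √(n + 1))
      ≤ ∑ n ∈ Finset.range (T + 1), a ^ n * b ^ (T - n) * (T.choose n) *
          ((s / 2) * (1 / (n + 1)) + 1 / (2 * s)) := by
        gcongr with n _; exact h3 n
    _ = (s / 2) * ∑ n ∈ Finset.range (T + 1), a ^ n * b ^ (T - n) * (T.choose n) * (1 / (n + 1)) +
          1 / (2 * s) * ∑ n ∈ Finset.range (T + 1), a ^ n * b ^ (T - n) * (T.choose n) := by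
        rw [Finset.mul_sum, Finset.mul_sum, ← Finset.sum_add_distrib]
        exact Finset.sum_congr rfl fun n _ => by ring
    _ ≤ (s / 2) * (1 / s ^ 2) + 1 / (2 * s) * 1 := by
        rw [h1, hs2]; gcongr
    _ = 1 / s := by field_simp; norm_num

theorem monotone_sum_shift {κ : Type*} (t : Finset κ) (u : κ → Site d) {c : ℝ} (hc : 0 ≤ c) :
    Monotone (c • ∑ k ∈ t, shift (u k) : Module.End ℝ (Site d → ℝ)) := by
  intro f g hfg v
  simp only [LinearMap.smul_apply, LinearMap.sum_apply, Pi.smul_apply, Finset.sum_apply,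
    shift_apply, smul_eq_mul]
  gcongr with k _
  exact hfg _

/-- The local bound for the simple random walk: after `T` steps it sits at a given site with
probability at most `√(d / (T + 1))`. The steps in a fixed coordinate direction are split off. -/
theorem walkStep_pow_single_le (hd : 1 ≤ d) (T : ℕ) (y v : Site d) :
    (walkStep d ^ T) (Pi.single y 1) v ≤ √(d / (T + 1)) := by
  classical
  have hd0 : (0 : ℝ) < d := by exact_mod_cast hd
  let i0 : Fin d := ⟨0, hd⟩
  let u : Site d := Pi.single i0 1
  have hu : u ≠ 0 := by
    intro h; have := congrFun h i0; simp [u] at this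
  let P : Finset (Fin d × ℤˣ) := (Finset.univ.erase i0) ×ˢ Finset.univ
  let W : Module.End ℝ (Site d → ℝ) :=
    (1 / (2 * d) : ℝ) • ∑ k ∈ P, shift (Pi.single k.1 (k.2 : ℤ))
  have hsplit : walkStep d = (1 / d : ℝ) • lineStep u + W := by
    rw [walkStep, ← Finset.add_sum_erase _ _ (Finset.mem_univ i0), smul_add]
    congr 1
    · rw [lineStep, smul_smul, one_div_mul_one_div, mul_comm (d : ℝ) 2]
      congr 1
      rw [show (Finset.univ : Finset ℤˣ) = {1, -1} from rfl, Finset.sum_pair (by decide)]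
      simp [u, Pi.single_neg]
    · simp only [W, P, Finset.sum_product]
  have hcomm : Commute ((1 / d : ℝ) • lineStep u) W := by
    refine Commute.smul_left (Commute.smul_right ?_ _) _
    refine Commute.sum_right _ _ _ fun k _ => ?_
    exact Commute.smul_left ((shift_comm _ _).add_left (shift_comm _ _)) _
  have hWmono : ∀ n, Monotone (W ^ n : Module.End ℝ (Site d → ℝ)) := fun n =>
    monotone_pow (monotone_sum_shift P _ (by positivity)) n
  have hWc : ∀ (n : ℕ) (c : ℝ), (W ^ n) (fun _ => c) = fun _ => (1 - 1 / d : ℝ) ^ n * c := by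
    have h1 : ∀ c : ℝ, W (fun _ => c) = fun _ => (1 - 1 / d : ℝ) * c := by
      intro c
      ext x
      simp only [W, LinearMap.smul_apply, LinearMap.sum_apply, Pi.smul_apply, Finset.sum_apply,
        shift_apply, smul_eq_mul, Finset.sum_const, P, Finset.card_product, Finset.card_univ,
        Fintype.card_units_int, Finset.card_erase_of_mem (Finset.mem_univ i0), Fintype.card_fin,
        nsmul_eq_mul]
      push_cast [hd]
      field_simp
    intro n
    induction n with
    | zero => simp
    | succ n ih =>
      intro c
      rw [pow_succ, Module.End.mul_apply, h1, ih]
      ext x; ring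
  have hterm : ∀ n m : ℕ, ((((1 / d : ℝ) • lineStep u) ^ n * W ^ m)) (Pi.single y 1) v ≤
      (1 / d) ^ n * (1 - 1 / d : ℝ) ^ m * (1 / √(n + 1)) := by
    intro n m
    rw [(hcomm.pow_pow n m).eq, Module.End.mul_apply, smul_pow (1 / d : ℝ) (lineStep u), LinearMap.smul_apply,
      (W ^ m).map_smul, Pi.smul_apply, smul_eq_mul, mul_assoc]
    gcongr
    have := hWmono m (fun x => lineStep_pow_single_le hu n y x) v
    rwa [hWc] at this
  have hb : (0 : ℝ) ≤ 1 - 1 / d := by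
    rw [sub_nonneg, div_le_one hd0]; exact_mod_cast hd
  calc (walkStep d ^ T) (Pi.single y 1) v
      = ∑ n ∈ Finset.range (T + 1),
          ((((1 / d : ℝ) • lineStep u) ^ n * W ^ (T - n))) (Pi.single y 1) v * T.choose n := by
        rw [hsplit, hcomm.add_pow, LinearMap.sum_apply, Finset.sum_apply]
        refine Finset.sum_congr rfl fun n _ => ?_
        rw [← nsmul_eq_mul', LinearMap.smul_apply, Pi.smul_apply, nsmul_eq_mul']
    _ ≤ ∑ n ∈ Finset.range (T + 1),
          (1 / d) ^ n * (1 - 1 / d : ℝ) ^ (T - n) * (T.choose n) * (1 / √(n + 1)) := by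
        refine Finset.sum_le_sum fun n _ => ?_
        calc _ ≤ (1 / d) ^ n * (1 - 1 / d : ℝ) ^ (T - n) * (1 / √(n + 1)) * T.choose n := by
              gcongr; exact hterm n (T - n)
          _ = _ := by ring
    _ ≤ 1 / √(1 / d * (T + 1)) := sum_choose_div_sqrt_le (by positivity) hb (by ring) T
    _ = _ := by
        rw [one_div, ← Real.sqrt_inv]
        congr 1
        field_simp

end Walk

/-! ### Labelled particles -/

section Move

variable {d : ℕ} {ι : Type*} [DecidableEq ι]

/-- The transition operator of one step of a simple random walk of the particle `i`. -/
def move (d : ℕ) (i : ι) : Module.End ℝ ((ι → Site d) → ℝ) :=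
  (1 / (2 * d) : ℝ) • ∑ j : Fin d, ∑ s : ℤˣ,
    LinearMap.funLeft ℝ ℝ fun x : ι → Site d =>
      Function.update x i (x i + Pi.single j (s : ℤ))

theorem move_apply (i : ι) (F : (ι → Site d) → ℝ) (x : ι → Site d) :
    move d i F x = (1 / (2 * d) : ℝ) * ∑ j : Fin d, ∑ s : ℤˣ,
      F (Function.update x i (x i + Pi.single j (s : ℤ))) := by
  simp [move, Finset.sum_apply, LinearMap.funLeft_apply]

theorem move_mono (i : ι) : Monotone (move d i) := by
  intro F G h x
  rw [move_apply, move_apply]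
  gcongr with j _ s _
  exact h _

theorem move_const (hd : 1 ≤ d) (i : ι) (c : ℝ) :
    move d i (fun _ => c) = fun _ => c := by
  have : (d : ℝ) ≠ 0 := by positivity
  ext x
  rw [move_apply]
  simp
  field_simp

theorem move_comm (i j : ι) : Commute (move d i) (move d j) := by
  by_cases h : i = j
  · subst h; exact Commute.refl _
  · refine Commute.smul_left (Commute.smul_right ?_ _) _
    refine Commute.sum_left _ _ _ fun a _ => Commute.sum_left _ _ _ fun s _ =>
      Commute.sum_right _ _ _ fun b _ => Commute.sum_right _ _ _ fun t _ => ?_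
    ext F x
    simp only [Module.End.mul_apply, LinearMap.funLeft_apply]
    rw [Function.update_of_ne h, Function.update_of_ne (Ne.symm h), Function.update_comm h]

theorem move_pow_apply (i : ι) (T : ℕ) (F : (ι → Site d) → ℝ) (x : ι → Site d) :
    (move d i ^ T) F x = (walkStep d ^ T) (fun v => F (Function.update x i v)) (x i) := by
  induction T generalizing F x with
  | zero => simp
  | succ T ih =>
    rw [pow_succ, Module.End.mul_apply, ih, pow_succ, Module.End.mul_apply]
    have : (fun v => move d i F (Function.update x i v)) =
        walkStep d fun v => F (Function.update x i v) := by
      ext v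
      rw [move_apply, walkStep_apply]
      simp
    rw [this]

end Move

section Labelled

variable {d : ℕ} {ι : Type*} [Fintype ι] {lam : ℝ} {V : Set (Site d)}

/-- The number of labels at the site `y`. -/
def labelCount (x : ι → Site d) (y : Site d) : ℕ := (Finset.univ.filter (x · = y)).card

theorem labelCount_pos (x : ι → Site d) (i : ι) : 0 < labelCount x (x i) :=
  Finset.card_pos.2 ⟨i, by simp⟩

theorem labelCount_eq_zero {x : ι → Site d} {y : Site d} (h : ∀ i, x i ≠ y) :
    labelCount x y = 0 := by
  simpa [labelCount] using h

open Classical in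
/-- The configuration with one particle at `x i` for each label `i`. The particles with label in `A`
have tried to fall asleep, which succeeds for a particle that is alone at its site. -/
def labelled (A : Finset ι) (x : ι → Site d) : Config d :=
  Finsupp.onFinset (Finset.univ.image x)
    (fun y => if ∃ i ∈ A, x i = y then (SiteState.active (labelCount x y)).trySleep
      else SiteState.active (labelCount x y))
    fun y hy => by
      by_contra h
      have h0 : ∀ i, x i ≠ y := by simpa using h
      simp only [labelCount_eq_zero h0] at hy
      split_ifs at hy <;> exact hy rfl

theorem labelled_apply (A : Finset ι) (x : ι → Site d) (y : Site d) [Decidable (∃ i ∈ A, x i = y)] :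
    labelled A x y = if ∃ i ∈ A, x i = y then (SiteState.active (labelCount x y)).trySleep
      else SiteState.active (labelCount x y) := by
  simp only [labelled, Finsupp.onFinset_apply]
  congr

theorem labelled_of_forall_ne {A : Finset ι} {x : ι → Site d} {y : Site d}
    (h : ∀ j ∈ A, x j ≠ y) : labelled A x y = SiteState.active (labelCount x y) := by
  classical
  rw [labelled_apply, if_neg]
  rintro ⟨j, hj, hjy⟩
  exact h j hj hjy

theorem active_labelled {A : Finset ι} {i : ι} {x : ι → Site d} (hx : ∀ j ∈ A, x j ≠ x i) :
    ((labelled A x) (x i)).numActive ≠ 0 := by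
  rw [labelled_of_forall_ne hx]
  exact (labelCount_pos x i).ne'

theorem escape_labelled_univ (hlam : 0 < lam) {x : ι → Site d} (hx : Function.Injective x)
    (hV : ∀ i, x i ∈ V) : escape lam V (labelled Finset.univ x) = 0 := by
  classical
  have h : ∀ y, (∀ i, x i ≠ y) → labelled Finset.univ x y = 0 := fun y hy => by
    rw [labelled_of_forall_ne fun j _ => hy j, labelCount_eq_zero hy]
    rfl
  refine escape_eq_zero hlam (fun y hy => h y ?_) fun y => ?_
  · rintro i rfl; exact hy (hV i)
  · by_cases hy : ∃ i, x i = y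
    · obtain ⟨i, rfl⟩ := hy
      have : labelCount x (x i) = 1 := by
        rw [labelCount, Finset.card_eq_one]
        exact ⟨i, by ext j; simp [hx.eq_iff]⟩
      rw [labelled_apply, if_pos ⟨i, Finset.mem_univ _, rfl⟩, this]
      rfl
    · push Not at hy
      rw [h y hy]
      rfl

variable [DecidableEq ι]

theorem labelCount_update (x : ι → Site d) (i : ι) (z y : Site d) :
    labelCount (Function.update x i z) y + (if x i = y then 1 else 0) =
      labelCount x y + (if z = y then 1 else 0) := by
  simp only [labelCount, Finset.card_filter]
  rw [← Finset.add_sum_erase _ _ (Finset.mem_univ i),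
    ← Finset.add_sum_erase (f := fun j => if x j = y then 1 else 0) _ (Finset.mem_univ i),
    Function.update_self]
  have : ∑ j ∈ Finset.univ.erase i, (if Function.update x i z j = y then 1 else 0) =
      ∑ j ∈ Finset.univ.erase i, (if x j = y then 1 else 0) :=
    Finset.sum_congr rfl fun j hj => by rw [Function.update_of_ne (Finset.ne_of_mem_erase hj)]
  rw [this]
  ring

theorem SiteState.trySleep_trySleep (s : SiteState) : s.trySleep.trySleep = s.trySleep := by
  cases s with
  | sleeping => rfl
  | active n => simp only [trySleep]; split_ifs <;> simp [*]

theorem labelled_insert (A : Finset ι) (i : ι) (x : ι → Site d) :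
    labelled (insert i A) x = sleepAt (labelled A x) (x i) := by
  classical
  ext y
  rw [sleepAt_apply, labelled_apply, labelled_apply, labelled_apply]
  by_cases hy : y = x i
  · subst hy
    rw [if_pos rfl, if_pos ⟨i, by simp, rfl⟩]
    split_ifs
    · rw [SiteState.trySleep_trySleep]
    · rfl
  · have : (∃ j ∈ insert i A, x j = y) ↔ ∃ j ∈ A, x j = y := by
      simp only [Finset.mem_insert, exists_eq_or_imp]
      exact ⟨fun h => h.resolve_left fun h => hy h.symm, Or.inr⟩
    simp only [this, hy, if_false]

theorem jumpFromTo_labelled {A : Finset ι} {i : ι} (hi : i ∉ A) {x : ι → Site d}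
    (hx : ∀ j ∈ A, x j ≠ x i) {z : Site d} (hz : z ≠ x i) :
    jumpFromTo (labelled A x) (x i) z = labelled A (Function.update x i z) := by
  classical
  have hc := labelCount_pos x i
  have hxi := labelled_of_forall_ne hx
  have hact : ((labelled A x) (x i)).numActive ≠ 0 := by
    rw [hxi]; exact hc.ne'
  have hex : ∀ y, (∃ j ∈ A, Function.update x i z j = y) ↔ ∃ j ∈ A, x j = y := fun y =>
    exists_congr fun j => and_congr_right fun hj => by
      rw [Function.update_of_ne (by rintro rfl; exact hi hj)]
  ext y
  have hcount := labelCount_update x i z y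
  rw [jumpFromTo_of_active hact, labelled_apply A (Function.update x i z) y]
  simp only [hex]
  by_cases hyz : y = z
  · subst hyz
    rw [if_pos rfl, labelled_apply]
    rw [if_neg (Ne.symm hz), if_pos rfl, add_zero] at hcount
    rw [hcount]
    split_ifs with h
    · obtain ⟨j, -, hj⟩ := h
      have hpos := labelCount_pos x j
      rw [hj] at hpos
      by_cases h1 : labelCount x y = 1
      · simp [SiteState.trySleep, SiteState.addOne, h1]
      · simp [SiteState.trySleep, SiteState.addOne, h1, hpos.ne']
    · rfl
  · rw [if_neg hyz]
    rw [if_neg (Ne.symm hyz), add_zero] at hcount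
    by_cases hyx : y = x i
    · subst hyx
      rw [if_pos rfl] at hcount
      rw [if_pos rfl, hxi, if_neg (by rintro ⟨j, hj, hj'⟩; exact hx j hj hj')]
      simp only [SiteState.removeOne]
      congr 1
      omega
    · rw [if_neg (Ne.symm hyx), add_zero] at hcount
      rw [if_neg hyx, labelled_apply, hcount]

theorem escape_labelled_le (hlam : 0 < lam) (A : Finset ι) (x : ι → Site d) :
    escape lam V (labelled A x) ≤ escape lam V (labelled ∅ x) := by
  induction A using Finset.induction_on with
  | empty => exact le_rfl
  | insert i A _ ih =>
    rw [labelled_insert]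
    exact (escape_sleepAt_le hlam _ _).trans ih

/-- One toppling of the site of a particle that has not yet tried to fall asleep. -/
theorem escape_labelled_le_move (hd : 1 ≤ d) (hlam : 0 < lam) {A : Finset ι} {i : ι} (hi : i ∉ A)
    {x : ι → Site d} (hx : ∀ j ∈ A, x j ≠ x i) (hV : x i ∈ V) :
    escape lam V (labelled A x) ≤
      lam / (lam + 2 * d) * escape lam V (labelled (insert i A) x) +
        (1 - lam / (lam + 2 * d)) * move d i (fun x => escape lam V (labelled A x)) x := by
  have hd0 : (0 : ℝ) < d := by exact_mod_cast hd
  have hpos := add_two_mul_pos (d := d) hlam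
  refine (escape_le_toppleMean hlam hV (active_labelled hx)).trans_eq ?_
  rw [toppleMean, move_apply, labelled_insert]
  simp only [jumpFromTo_labelled hi hx (add_single_unit_ne _ _ _)]
  field_simp
  ring

/-- Attempts to sleep may be ignored. -/
theorem escape_labelled_empty_le_move (hd : 1 ≤ d) (hlam : 0 < lam) (i : ι)
    {x : ι → Site d} (hV : x i ∈ V) :
    escape lam V (labelled ∅ x) ≤ move d i (fun x => escape lam V (labelled ∅ x)) x := by
  have hd0 : (0 : ℝ) < d := by exact_mod_cast hd
  have hpos := add_two_mul_pos (d := d) hlam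
  have h1 := escape_labelled_le_move (A := ∅) hd hlam (Finset.notMem_empty i) (x := x)
    (by simp) hV
  have h2 := escape_labelled_le (V := V) hlam (insert i ∅) x
  set p := lam / (lam + 2 * d) with hp
  have hp0 : 0 < p := by positivity
  have hp1 : 0 < 1 - p := by
    rw [sub_pos, hp, div_lt_one hpos]; linarith
  nlinarith

end Labelled

/-! ### One round of spreading out and settling -/

section Round

variable {d : ℕ} {ι : Type*} {lam : ℝ} {V : Set (Site d)}

/-- Weights `g i` that are nonnegative eigenfunctions of the simple random walk, and are at least `1`
outside `V`: up to powers of `μ`, they bound the probability that a random walk leaves `V`. -/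
structure IsExitWeight (V : Set (Site d)) (μ : ℝ) (g : ι → Site d → ℝ) : Prop where
  nonneg : ∀ i v, 0 ≤ g i v
  eigen : ∀ i v, walkStep d (g i) v = μ * g i v
  one_le : ∀ i v, v ∉ V → 1 ≤ g i v

/-- The total weight of the particles, with coefficients `β`. -/
def weightSum [Fintype ι] (g : ι → Site d → ℝ) (β : ι → ℝ) (x : ι → Site d) : ℝ :=
  ∑ i, β i * g i (x i)

/-- The indicator of the event that the particle `i` shares its site with another particle. -/
def shared (i : ι) (x : ι → Site d) : ℝ :=
  open Classical in if ∃ j, j ≠ i ∧ x j = x i then 1 else 0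

theorem shared_nonneg (i : ι) (x : ι → Site d) : 0 ≤ shared i x := by
  rw [shared]; split_ifs <;> norm_num

theorem weightSum_mono [Fintype ι] {μ : ℝ} {g : ι → Site d → ℝ} (hg : IsExitWeight V μ g) {β β' : ι → ℝ}
    (h : ∀ i, β i ≤ β' i) (x : ι → Site d) : weightSum g β x ≤ weightSum g β' x :=
  Finset.sum_le_sum fun i _ => mul_le_mul_of_nonneg_right (h i) (hg.nonneg i _)

theorem one_le_weightSum [Fintype ι] {μ : ℝ} {g : ι → Site d → ℝ} (hg : IsExitWeight V μ g) {β : ι → ℝ}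
    (h : ∀ i, 1 ≤ β i) {x : ι → Site d} {i : ι} (hi : x i ∉ V) : 1 ≤ weightSum g β x := by
  calc 1 ≤ β i * g i (x i) := one_le_mul_of_one_le_of_one_le (h i) (hg.one_le i _ hi)
    _ ≤ _ := Finset.single_le_sum (f := fun i => β i * g i (x i))
      (fun j _ => mul_nonneg (zero_le_one.trans (h j)) (hg.nonneg j _)) (Finset.mem_univ i)

theorem weightSum_nonneg [Fintype ι] {μ : ℝ} {g : ι → Site d → ℝ} (hg : IsExitWeight V μ g) {β : ι → ℝ}
    (h : ∀ i, 0 ≤ β i) (x : ι → Site d) : 0 ≤ weightSum g β x :=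
  Finset.sum_nonneg fun i _ => mul_nonneg (h i) (hg.nonneg i _)

variable [DecidableEq ι]

theorem move_eq_walkStep (i : ι) (F : (ι → Site d) → ℝ) (x : ι → Site d) :
    move d i F x = walkStep d (fun v => F (Function.update x i v)) (x i) := by
  simpa using move_pow_apply i 1 F x

/-- A bound for the probability of the following event. The particle `i` walks until it falls asleep,
with probability `p` before each step; either it meets another particle or has not fallen asleep
within `n` steps, and then an event of probability `α` occurs, or it falls asleep, and then an event
occurs whose probability is given by `F`. -/
def runBound (p α : ℝ) (i : ι) (F : (ι → Site d) → ℝ) : ℕ → (ι → Site d) → ℝ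
  | 0 => fun _ => α
  | n + 1 => p • F + α • shared i + (1 - p) • move d i (runBound p α i F n)

theorem runBound_nonneg {p α : ℝ} (hp0 : 0 ≤ p) (hp1 : p ≤ 1) (hα : 0 ≤ α) (i : ι)
    {F : (ι → Site d) → ℝ} (hF : ∀ x, 0 ≤ F x) (n : ℕ) (x : ι → Site d) :
    0 ≤ runBound p α i F n x := by
  induction n generalizing x with
  | zero => exact hα
  | succ n ih =>
    simp only [runBound, Pi.add_apply, Pi.smul_apply, smul_eq_mul]
    have h1 := hF x
    have h2 := shared_nonneg i x
    have h3 : 0 ≤ move d i (runBound p α i F n) x := by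
      rw [move_apply]
      have := ih
      have : 0 ≤ ∑ j : Fin d, ∑ s : ℤˣ,
        runBound p α i F n (Function.update x i (x i + Pi.single j (s : ℤ))) :=
        Finset.sum_nonneg fun _ _ => Finset.sum_nonneg fun _ _ => ih _
      positivity
    have := sub_nonneg.2 hp1
    positivity

/-- Averaging over independent random walks of `T` steps of the particles in `l`. -/
def spread (d T : ℕ) (l : List ι) : Module.End ℝ ((ι → Site d) → ℝ) :=
  (l.map fun i => move d i ^ T).prod

theorem spread_cons (T : ℕ) (i : ι) (l : List ι) :
    spread d T (i :: l) = move d i ^ T * spread d T l := by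
  simp [spread]

theorem spread_mono (T : ℕ) (l : List ι) : Monotone (spread d T l) := by
  induction l with
  | nil => exact monotone_id
  | cons i l ih =>
    rw [spread_cons, Module.End.coe_mul]
    exact (monotone_pow (move_mono i) T).comp ih

theorem move_pow_const (hd : 1 ≤ d) (i : ι) (T : ℕ) (c : ℝ) :
    (move d i ^ T) (fun _ => c) = fun _ => c := by
  induction T with
  | zero => rfl
  | succ T ih => rw [pow_succ, Module.End.mul_apply, move_const hd, ih]

theorem spread_const (hd : 1 ≤ d) (T : ℕ) (l : List ι) (c : ℝ) :
    spread d T l (fun _ => c) = fun _ => c := by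
  induction l with
  | nil => simp [spread]
  | cons i l ih => rw [spread_cons, Module.End.mul_apply, ih, move_pow_const hd]

theorem commute_move_spread (T : ℕ) (i : ι) (l : List ι) :
    Commute (move d i) (spread d T l) := by
  induction l with
  | nil => exact Commute.one_right _
  | cons j l ih => rw [spread_cons]; exact ((move_comm i j).pow_right T).mul_right ih

theorem spread_runBound_le (hd : 1 ≤ d) {p α e κ : ℝ} (hp0 : 0 < p) (hp1 : p ≤ 1) (hα : 0 ≤ α)
    (he : 0 ≤ e) {T : ℕ} {l : List ι} {i : ι}
    (hκ : ∀ x, spread d T l (shared i) x ≤ κ) (hκ0 : 0 ≤ κ) {F : (ι → Site d) → ℝ}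
    (hF : ∀ x, spread d T l F x ≤ e) (n : ℕ) (x : ι → Site d) :
    spread d T l (runBound p α i F n) x ≤ e + α * (κ / p + (1 - p) ^ n) := by
  induction n generalizing x with
  | zero =>
    simp only [runBound, spread_const hd, pow_zero]
    have : 0 ≤ α * (κ / p) := by positivity
    linarith
  | succ n ih =>
    have hm : spread d T l (move d i (runBound p α i F n)) x ≤ e + α * (κ / p + (1 - p) ^ n) := by
      rw [← Module.End.mul_apply, ← (commute_move_spread T i l).eq, Module.End.mul_apply]
      have := move_mono i (d := d) (show _ ≤ fun _ => _ from ih) x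
      rwa [move_const hd] at this
    simp only [runBound, map_add, map_smul, Pi.add_apply, Pi.smul_apply, smul_eq_mul]
    have h1 := mul_le_mul_of_nonneg_left (hF x) hp0.le
    have h2 := mul_le_mul_of_nonneg_left (hκ x) hα
    have h3 := mul_le_mul_of_nonneg_left hm (sub_nonneg.2 hp1)
    have h4 : p * (α * (κ / p)) = α * κ := by field_simp
    calc _ ≤ p * e + α * κ + (1 - p) * (e + α * (κ / p + (1 - p) ^ n)) := by linarith
      _ = _ := by rw [← h4]; ring

variable [Fintype ι]

theorem move_weightSum (hd : 1 ≤ d) {μ : ℝ} {g : ι → Site d → ℝ} (hg : IsExitWeight V μ g)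
    (i : ι) (β : ι → ℝ) :
    move d i (weightSum g β) = weightSum g (Function.update β i (μ * β i)) := by
  have h1 : weightSum g β = ∑ k, β k • fun x : ι → Site d => g k (x k) := by
    ext x; simp [weightSum, Finset.sum_apply]
  have hk : ∀ k, β k • move d i (fun x : ι → Site d => g k (x k)) =
      (Function.update β i (μ * β i)) k • fun x : ι → Site d => g k (x k) := by
    intro k
    by_cases h : k = i
    · subst h
      ext x
      rw [Function.update_self, Pi.smul_apply, Pi.smul_apply, move_eq_walkStep]
      simp only [Function.update_self]
      have : walkStep d (fun v => g k v) (x k) = μ * g k (x k) := hg.eigen k (x k)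
      rw [this, smul_eq_mul, smul_eq_mul]
      ring
    · rw [Function.update_of_ne h]
      congr 1
      ext x
      rw [move_apply]
      simp only [Function.update_of_ne h]
      have := congrFun (move_const (d := d) hd i (g k (x k))) x
      rw [move_apply] at this
      exact this
  rw [h1, map_sum]
  simp only [map_smul, hk]
  ext x; simp [weightSum, Finset.sum_apply]

theorem shared_le (i : ι) (x : ι → Site d) :
    shared i x ≤ ∑ j ∈ Finset.univ.erase i, (Pi.single (x j) 1 : Site d → ℝ) (x i) := by
  rw [shared]
  have h0 : ∀ j ∈ Finset.univ.erase i, 0 ≤ (Pi.single (x j) 1 : Site d → ℝ) (x i) := fun j _ => by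
    by_cases h : x i = x j
    · rw [h, Pi.single_eq_same]; norm_num
    · rw [Pi.single_eq_of_ne h]
  split_ifs with h
  · obtain ⟨j, hj, hji⟩ := h
    refine le_trans ?_ (Finset.single_le_sum h0 (Finset.mem_erase.2 ⟨hj, Finset.mem_univ j⟩))
    rw [hji, Pi.single_eq_same]
  · exact Finset.sum_nonneg h0

theorem move_pow_shared_le (hd : 1 ≤ d) (i : ι) (T : ℕ) (x : ι → Site d) :
    (move d i ^ T) (shared i) x ≤ Fintype.card ι * √(d / (T + 1)) := by
  have h1 : (shared i : (ι → Site d) → ℝ) ≤ ∑ j ∈ Finset.univ.erase i,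
      fun x : ι → Site d => (Pi.single (x j) 1 : Site d → ℝ) (x i) := fun x => by
    simpa [Finset.sum_apply] using shared_le i x
  refine (monotone_pow (move_mono i) T h1 x).trans ?_
  rw [map_sum, Finset.sum_apply]
  calc _ ≤ ∑ j ∈ Finset.univ.erase i, √((d : ℝ) / (T + 1)) := by
        refine Finset.sum_le_sum fun j hj => ?_
        rw [move_pow_apply]
        simp only [Function.update_of_ne (Finset.ne_of_mem_erase hj), Function.update_self]
        exact walkStep_pow_single_le hd T (x j) (x i)
    _ ≤ _ := by
        rw [Finset.sum_const, nsmul_eq_mul]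
        gcongr
        exact Finset.card_le_univ _

/-- Settling one particle, while those in `A` are already asleep. The coefficient of its exit weight is
doubled, which makes up for the growth by the factor `μ` in each step of the run. -/
theorem escape_labelled_le_runBound (hd : 1 ≤ d) (hlam : 0 < lam) {p : ℝ}
    (hp : p = lam / (lam + 2 * d)) {μ : ℝ} (hpμ : p + 2 * (1 - p) * μ ≤ 2)
    {g : ι → Site d → ℝ} (hg : IsExitWeight V μ g) {α b : ℝ} (hα : 0 ≤ α) (hb : 1 ≤ b)
    (hQ : ∀ x : ι → Site d, escape lam V (labelled ∅ x) ≤ α + weightSum g (fun _ => b) x)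
    {A : Finset ι} {i : ι} (hi : i ∉ A) {β : ι → ℝ} (hβ : ∀ j, b ≤ β j)
    {F : (ι → Site d) → ℝ} (hF : ∀ x, 0 ≤ F x)
    (hH : ∀ x, escape lam V (labelled (insert i A) x) ≤ F x + weightSum g β x) (n : ℕ)
    (x : ι → Site d) :
    escape lam V (labelled A x) ≤
      runBound p α i F n x + weightSum g (Function.update β i (2 * β i)) x := by
  have hd0 : (0 : ℝ) < d := by exact_mod_cast hd
  have hpos := add_two_mul_pos (d := d) hlam
  have hp0 : 0 < p := by rw [hp]; positivity
  have hp1 : p < 1 := by rw [hp, div_lt_one hpos]; linarith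
  set β' := Function.update β i (2 * β i) with hβ'
  have hββ' : ∀ j, β j ≤ β' j := fun j => by
    by_cases h : j = i
    · subst h; rw [hβ', Function.update_self]; linarith [hβ j]
    · rw [hβ', Function.update_of_ne h]
  have hfall : ∀ x, escape lam V (labelled A x) ≤ α + weightSum g β' x := fun x =>
    (escape_labelled_le hlam A x).trans ((hQ x).trans
      (add_le_add_right (weightSum_mono hg (fun j => (hβ j).trans (hββ' j)) x) α))
  induction n generalizing x with
  | zero => exact hfall x
  | succ n ih =>
    have hR := runBound_nonneg (d := d) hp0.le hp1.le hα i hF n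
    have hR1 := runBound_nonneg (d := d) hp0.le hp1.le hα i hF (n + 1) x
    by_cases hV : x i ∈ V
    swap
    · have := one_le_weightSum hg (β := β') (fun j => hb.trans ((hβ j).trans (hββ' j))) hV
      exact (escape_le_one hlam).trans (by linarith)
    have hmove : 0 ≤ move d i (runBound p α i F n) x := by
      have := move_mono i (d := d) (show (fun _ => (0 : ℝ)) ≤ runBound p α i F n from hR) x
      rwa [move_const hd] at this
    by_cases hs : ∃ j, j ≠ i ∧ x j = x i
    · refine (hfall x).trans ?_
      have hs1 : shared i x = 1 := by rw [shared, if_pos hs]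
      simp only [runBound, Pi.add_apply, Pi.smul_apply, smul_eq_mul, hs1, mul_one]
      have h1 := mul_nonneg hp0.le (hF x)
      have h2 := mul_nonneg (sub_nonneg.2 hp1.le) hmove
      linarith
    · push Not at hs
      have hs0 := mul_nonneg hα (shared_nonneg i x)
      have hstep := escape_labelled_le_move (V := V) hd hlam hi
        (fun j hj => hs j (by rintro rfl; exact hi hj)) hV
      rw [← hp] at hstep
      have hm : move d i (fun x => escape lam V (labelled A x)) x ≤
          move d i (runBound p α i F n) x +
            weightSum g (Function.update β' i (μ * β' i)) x := by
        have := move_mono i (d := d) (show (fun x => escape lam V (labelled A x)) ≤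
          runBound p α i F n + weightSum g β' from ih) x
        rwa [map_add, move_weightSum hd hg, Pi.add_apply] at this
      have hw : p * weightSum g β x +
          (1 - p) * weightSum g (Function.update β' i (μ * β' i)) x ≤ weightSum g β' x := by
        rw [weightSum, weightSum, weightSum, Finset.mul_sum, Finset.mul_sum,
          ← Finset.sum_add_distrib]
        refine Finset.sum_le_sum fun j _ => ?_
        have hg0 := hg.nonneg j (x j)
        by_cases h : j = i
        · subst h
          rw [Function.update_self, hβ', Function.update_self]
          have hβj : 0 ≤ β j := by linarith [hβ j]
          have := mul_le_mul_of_nonneg_right hpμ (mul_nonneg hβj hg0)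
          linarith
        · rw [Function.update_of_ne h, hβ', Function.update_of_ne h]
          linarith
      simp only [runBound, Pi.add_apply, Pi.smul_apply, smul_eq_mul]
      have h1 := mul_le_mul_of_nonneg_left (hH x) hp0.le
      have h2 := mul_le_mul_of_nonneg_left hm (sub_nonneg.2 hp1.le)
      linarith

theorem spread_shared_le (hd : 1 ≤ d) (T : ℕ) {l : List ι} {i : ι} (hi : i ∈ l)
    (x : ι → Site d) :
    spread d T l (shared i) x ≤ Fintype.card ι * √(d / (T + 1)) := by
  induction l generalizing x with
  | nil => simp at hi
  | cons j l ih =>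
    rw [spread_cons]
    by_cases h : i ∈ l
    · have := monotone_pow (move_mono j) T (show _ ≤ fun _ => _ from ih h) x
      rwa [move_pow_const hd] at this
    · have hij : i = j := (List.mem_cons.1 hi).resolve_right h
      subst hij
      rw [((commute_move_spread T i l).pow_left T).eq, Module.End.mul_apply]
      have := spread_mono T l (show _ ≤ fun _ => _ from move_pow_shared_le (d := d) hd i T) x
      rwa [spread_const hd] at this

/-- Settling all particles, one after the other. -/
theorem exists_escape_labelled_compl_le (hd : 1 ≤ d) (hlam : 0 < lam) {p : ℝ}
    (hp : p = lam / (lam + 2 * d)) {μ : ℝ} (hpμ : p + 2 * (1 - p) * μ ≤ 2)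
    {g : ι → Site d → ℝ} (hg : IsExitWeight V μ g) {α b : ℝ} (hα : 0 ≤ α) (hb : 1 ≤ b)
    (hQ : ∀ x : ι → Site d, escape lam V (labelled ∅ x) ≤ α + weightSum g (fun _ => b) x)
    {κ : ℝ} (hκ0 : 0 ≤ κ) {T : ℕ} {l : List ι} (hκ : ∀ i x, spread d T l (shared i) x ≤ κ) (n : ℕ)
    (B : Finset ι) :
    ∃ F : (ι → Site d) → ℝ, (∀ x, 0 ≤ F x) ∧
      (∀ x, spread d T l F x ≤
        α * (Fintype.card ι * κ) + B.card * (α * (κ / p + (1 - p) ^ n))) ∧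
      ∀ x, escape lam V (labelled Bᶜ x) ≤
        F x + weightSum g (fun i => if i ∈ B then 2 * b else b) x := by
  have hd0 : (0 : ℝ) < d := by exact_mod_cast hd
  have hpos := add_two_mul_pos (d := d) hlam
  have hp0 : 0 < p := by rw [hp]; positivity
  have hp1 : p < 1 := by rw [hp, div_lt_one hpos]; linarith
  induction B using Finset.induction_on with
  | empty =>
    refine ⟨α • ∑ i, shared i, fun x => ?_, fun x => ?_, fun x => ?_⟩
    · simp only [Pi.smul_apply, Finset.sum_apply, smul_eq_mul]
      exact mul_nonneg hα (Finset.sum_nonneg fun i _ => shared_nonneg i x)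
    · simp only [map_smul, map_sum, Pi.smul_apply, Finset.sum_apply, smul_eq_mul,
        Finset.card_empty, Nat.cast_zero, zero_mul, add_zero]
      gcongr
      refine (Finset.sum_le_sum fun i _ => hκ i x).trans_eq ?_
      simp
    · simp only [Finset.notMem_empty, if_false, Finset.compl_empty, Pi.smul_apply,
        Finset.sum_apply, smul_eq_mul]
      have h0 : 0 ≤ α * ∑ i, shared i x :=
        mul_nonneg hα (Finset.sum_nonneg fun i _ => shared_nonneg i x)
      have hw0 := weightSum_nonneg hg (β := fun _ => b) (fun _ => zero_le_one.trans hb) x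
      by_cases hV : ∀ i, x i ∈ V
      swap
      · push Not at hV
        obtain ⟨i, hi⟩ := hV
        have := one_le_weightSum hg (β := fun _ => b) (fun _ => hb) hi
        exact (escape_le_one hlam).trans (by linarith)
      by_cases hx : Function.Injective x
      · rw [escape_labelled_univ hlam hx hV]
        linarith
      · refine (escape_labelled_le hlam _ x).trans ((hQ x).trans ?_)
        gcongr
        rw [Function.Injective] at hx
        push Not at hx
        obtain ⟨i, j, hij, hne⟩ := hx
        have h1 : shared j x = 1 := by rw [shared, if_pos ⟨i, hne, hij⟩]
        refine le_mul_of_one_le_right hα ?_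
        rw [← h1]
        exact Finset.single_le_sum (f := fun i => shared i x) (fun i _ => shared_nonneg i x)
          (Finset.mem_univ j)
  | insert i B hi ih =>
    obtain ⟨F, hF0, hFs, hFH⟩ := ih
    have hins : insert i (insert i B)ᶜ = Bᶜ := by
      ext j; simp only [Finset.mem_insert, Finset.mem_compl]; grind
    have hnot : i ∉ (insert i B)ᶜ := by simp
    have hq : 0 ≤ 1 - p := by linarith
    refine ⟨runBound p α i F n, runBound_nonneg hp0.le hp1.le hα i hF0 n, fun x => ?_, fun x => ?_⟩
    · refine (spread_runBound_le hd hp0 hp1.le hα (by positivity) (hκ i) hκ0 hFs n x).trans_eq ?_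
      rw [Finset.card_insert_of_notMem hi]
      push_cast
      ring
    · have := escape_labelled_le_runBound hd hlam hp hpμ hg hα hb hQ hnot
        (β := fun i => if i ∈ B then 2 * b else b)
        (fun j => by split_ifs <;> linarith) hF0 (by rwa [hins]) n x
      refine this.trans_eq ?_
      congr 2
      ext j
      by_cases h : j = i
      · subst h; rw [Function.update_self]; simp [hi]
      · rw [Function.update_of_ne h]; simp [h]

/-- Spreading out: the particles in `l` first make `T` steps each, without attempts to sleep. -/
theorem escape_labelled_empty_le_spread (hd : 1 ≤ d) (hlam : 0 < lam) {μ : ℝ} (hμ : 1 ≤ μ)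
    {g : ι → Site d → ℝ} (hg : IsExitWeight V μ g) {F : (ι → Site d) → ℝ} (hF : ∀ x, 0 ≤ F x)
    {b : ℝ} (hb : 1 ≤ b)
    (h : ∀ x : ι → Site d, escape lam V (labelled ∅ x) ≤ F x + weightSum g (fun _ => b) x)
    (T : ℕ) (l : List ι) (x : ι → Site d) :
    escape lam V (labelled ∅ x) ≤
      spread d T l F x + weightSum g (fun i => μ ^ (T * l.count i) * b) x := by
  have key : ∀ (i : ι) (F : (ι → Site d) → ℝ), (∀ x, 0 ≤ F x) → ∀ β : ι → ℝ, (∀ j, 1 ≤ β j) →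
      (∀ x : ι → Site d, escape lam V (labelled ∅ x) ≤ F x + weightSum g β x) → ∀ n : ℕ,
      ∀ x : ι → Site d, escape lam V (labelled ∅ x) ≤
        (move d i ^ n) F x + weightSum g (Function.update β i (μ ^ n * β i)) x := by
    intro i F hF β hβ h n
    induction n with
    | zero => simpa using h
    | succ n ih =>
      intro x
      have h0 : ∀ m, 0 ≤ (move d i ^ m) F x := fun m => by
        have := monotone_pow (move_mono i (d := d)) m (show (fun _ => (0 : ℝ)) ≤ F from hF) x
        rwa [move_pow_const hd] at this
      by_cases hV : x i ∈ V
      · refine (escape_labelled_empty_le_move hd hlam i hV).trans ?_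
        have := move_mono i (d := d) (show (fun x => escape lam V (labelled ∅ x)) ≤
          (move d i ^ n) F + weightSum g (Function.update β i (μ ^ n * β i)) from ih) x
        rw [map_add, move_weightSum hd hg, Pi.add_apply] at this
        refine this.trans_eq ?_
        rw [pow_succ', Module.End.mul_apply, Function.update_idem, Function.update_self, pow_succ',
          mul_assoc]
      · refine (escape_le_one hlam).trans ?_
        have := one_le_weightSum hg (β := Function.update β i (μ ^ (n + 1) * β i)) (fun j => by
          by_cases hj : j = i
          · subst hj; rw [Function.update_self]
            exact one_le_mul_of_one_le_of_one_le (one_le_pow₀ hμ) (hβ j)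
          · rw [Function.update_of_ne hj]; exact hβ j) hV
        linarith [h0 (n + 1)]
  induction l generalizing x with
  | nil => simpa [spread] using h x
  | cons i l ih =>
    have hs : ∀ x, 0 ≤ spread d T l F x := fun x => by
      have := spread_mono T l (show (fun _ => (0 : ℝ)) ≤ F from hF) x
      rwa [spread_const hd] at this
    have := key i (spread d T l F) hs (fun i => μ ^ (T * l.count i) * b)
      (fun j => one_le_mul_of_one_le_of_one_le (one_le_pow₀ hμ) hb) ih T x
    rw [spread_cons, Module.End.mul_apply]
    refine this.trans_eq ?_
    congr 2
    ext j
    by_cases hj : j = i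
    · subst hj
      rw [Function.update_self, List.count_cons_self, mul_add, mul_one, pow_add]
      ring
    · rw [Function.update_of_ne hj, List.count_cons_of_ne (Ne.symm hj)]

/-- One round. First all particles spread out, so that they rarely share sites, and then they settle
one after the other; in case of a collision, all particles are woken up and the bound that is
available before the round is used. -/
theorem escape_labelled_round (hd : 1 ≤ d) (hlam : 0 < lam) {p : ℝ}
    (hp : p = lam / (lam + 2 * d)) {μ : ℝ} (hμ : 1 ≤ μ) (hpμ : p + 2 * (1 - p) * μ ≤ 2)
    {g : ι → Site d → ℝ} (hg : IsExitWeight V μ g) {T : ℕ}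
    (hT : (Fintype.card ι : ℝ) ^ 2 * √(d / (T + 1)) * (1 + 1 / p) ≤ 1 / 4)
    {α b : ℝ} (hα : 0 ≤ α) (hb : 1 ≤ b)
    (hQ : ∀ x : ι → Site d, escape lam V (labelled ∅ x) ≤ α + weightSum g (fun _ => b) x)
    (x : ι → Site d) :
    escape lam V (labelled ∅ x) ≤
      α / 2 + weightSum g (fun _ => μ ^ T * (2 * b)) x := by
  have hd0 : (0 : ℝ) < d := by exact_mod_cast hd
  have hpos := add_two_mul_pos (d := d) hlam
  have hp0 : 0 < p := by rw [hp]; positivity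
  have hp1 : p < 1 := by rw [hp, div_lt_one hpos]; linarith
  obtain ⟨n, hn⟩ : ∃ n : ℕ, (Fintype.card ι : ℝ) * (1 - p) ^ n ≤ 1 / 4 := by
    have := (tendsto_pow_atTop_nhds_zero_of_lt_one (sub_nonneg.2 hp1.le)
      (by linarith : 1 - p < 1)).const_mul (Fintype.card ι : ℝ)
    rw [mul_zero] at this
    exact ((this.eventually (eventually_le_nhds (by norm_num))).exists)
  set l := (Finset.univ : Finset ι).toList with hl
  have hmem : ∀ i, i ∈ l := fun i => by simp [hl]
  have hcount : ∀ i, l.count i = 1 := fun i =>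
    List.count_eq_one_of_mem (Finset.nodup_toList _) (hmem i)
  set κ := (Fintype.card ι : ℝ) * √(d / (T + 1)) with hκ
  have hκ0 : 0 ≤ κ := by positivity
  obtain ⟨F, hF0, hFs, hFH⟩ := exists_escape_labelled_compl_le hd hlam hp hpμ hg hα hb hQ hκ0
    (fun i => spread_shared_le hd T (hmem i)) n Finset.univ
  simp only [Finset.compl_univ, Finset.mem_univ, if_true] at hFH
  have h := escape_labelled_empty_le_spread hd hlam hμ hg hF0 (by linarith) hFH T l x
  simp only [hcount, mul_one] at h
  refine h.trans ?_
  gcongr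
  refine (hFs x).trans ?_
  rw [Finset.card_univ]
  calc α * (Fintype.card ι * κ) + Fintype.card ι * (α * (κ / p + (1 - p) ^ n))
      = α * ((Fintype.card ι : ℝ) ^ 2 * √(d / (T + 1)) * (1 + 1 / p) +
          Fintype.card ι * (1 - p) ^ n) := by rw [hκ]; ring
    _ ≤ α * (1 / 4 + 1 / 4) := by gcongr
    _ = α / 2 := by ring

/-- Several rounds. -/
theorem escape_labelled_rounds (hd : 1 ≤ d) (hlam : 0 < lam) {p : ℝ}
    (hp : p = lam / (lam + 2 * d)) {μ : ℝ} (hμ : 1 ≤ μ) (hpμ : p + 2 * (1 - p) * μ ≤ 2)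
    {g : ι → Site d → ℝ} (hg : IsExitWeight V μ g) {T : ℕ}
    (hT : (Fintype.card ι : ℝ) ^ 2 * √(d / (T + 1)) * (1 + 1 / p) ≤ 1 / 4) (J : ℕ)
    (x : ι → Site d) :
    escape lam V (labelled ∅ x) ≤
      (1 / 2) ^ J + weightSum g (fun _ => (2 * μ ^ T) ^ J) x := by
  induction J generalizing x with
  | zero =>
    refine (escape_le_one hlam).trans ?_
    have := weightSum_nonneg hg (β := fun _ => (2 * μ ^ T) ^ 0) (fun _ => by simp) x
    simpa using this
  | succ J ih =>
    have h1 : 1 ≤ 2 * μ ^ T := by linarith [one_le_pow₀ hμ (n := T)]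
    have := escape_labelled_round hd hlam hp hμ hpμ hg hT (by positivity)
      (one_le_pow₀ h1) ih x
    refine this.trans_eq ?_
    congr 1
    · ring
    · congr 1; ext i; ring

end Round

/-! ### Few particles do not spread far -/

section Few

variable {d : ℕ}

theorem walkStep_cosh (hd : 1 ≤ d) (θ : ℝ) (a : Site d) (c : Fin d) (v : Site d) :
    walkStep d (fun v => Real.cosh (θ * ((v c : ℝ) - a c))) v =
      (1 + (Real.cosh θ - 1) / d) * Real.cosh (θ * ((v c : ℝ) - a c)) := by
  have hd0 : (0 : ℝ) < d := by exact_mod_cast hd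
  set X := θ * ((v c : ℝ) - a c) with hX
  have hs : ∀ f : ℤˣ → ℝ, ∑ s : ℤˣ, f s = f 1 + f (-1) := fun f => by
    rw [show (Finset.univ : Finset ℤˣ) = {1, -1} from rfl, Finset.sum_pair (by decide)]
  have h1 : ∀ i : Fin d, ∑ s : ℤˣ,
      Real.cosh (θ * (((v + Pi.single i (s : ℤ) : Site d) c : ℝ) - a c)) =
      2 * Real.cosh X + if i = c then 2 * (Real.cosh θ - 1) * Real.cosh X else 0 := by
    intro i
    rw [hs]
    by_cases h : i = c
    · subst h
      have e1 : θ * (((v + Pi.single i ((1 : ℤˣ) : ℤ) : Site d) i : ℝ) - a i) = X + θ := by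
        simp [hX]; ring
      have e2 : θ * (((v + Pi.single i ((-1 : ℤˣ) : ℤ) : Site d) i : ℝ) - a i) = X - θ := by
        simp [hX]; ring
      rw [e1, e2, Real.cosh_add, Real.cosh_sub, if_pos rfl]
      ring
    · have e : ∀ s : ℤˣ, θ * (((v + Pi.single i (s : ℤ) : Site d) c : ℝ) - a c) = X := by
        intro s
        simp [hX, Pi.single_eq_of_ne (Ne.symm h)]
      rw [e, e, if_neg h]
      ring
  rw [walkStep_apply]
  simp only [h1, Finset.sum_add_distrib, Finset.sum_const, Finset.card_univ, Fintype.card_fin,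
    nsmul_eq_mul, Finset.sum_ite_eq', Finset.mem_univ, if_true]
  field_simp

/-- An exit weight for the ball of radius `D` around `a`, built from hyperbolic cosines of the
coordinates. -/
def coshWeight (θ D : ℝ) (a v : Site d) : ℝ :=
  Real.exp (-(θ * D)) * ∑ c, 2 * Real.cosh (θ * ((v c : ℝ) - a c))

theorem isExitWeight_coshWeight {ι : Type*} (hd : 1 ≤ d) {θ : ℝ} (hθ : 0 ≤ θ) {D : ℝ}
    (a : ι → Site d) {V : Set (Site d)} (hV : ∀ i v, dist v (a i) < D → v ∈ V) :
    IsExitWeight V (1 + (Real.cosh θ - 1) / d) fun i => coshWeight θ D (a i) where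
  nonneg i v := by
    have : 0 ≤ ∑ c, 2 * Real.cosh (θ * ((v c : ℝ) - a i c)) :=
      Finset.sum_nonneg fun c _ => by positivity
    unfold coshWeight
    positivity
  eigen i v := by
    have h1 : coshWeight θ D (a i) = Real.exp (-(θ * D)) •
        ∑ c, (2 : ℝ) • fun v : Site d => Real.cosh (θ * ((v c : ℝ) - a i c)) := by
      ext v; simp [coshWeight, Finset.sum_apply]
    rw [h1]
    simp only [map_smul, map_sum, Pi.smul_apply, Finset.sum_apply, walkStep_cosh hd, smul_eq_mul,
      Finset.mul_sum]
    exact Finset.sum_congr rfl fun c _ => by ring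
  one_le i v hv := by
    have h1 : ¬ ∀ c, dist (v c) (a i c) < D := fun h => by
      by_cases hD : 0 < D
      · exact hv (hV i v ((dist_pi_lt_iff hD).2 h))
      · exact hD (dist_nonneg.trans_lt (h ⟨0, hd⟩))
    push Not at h1
    obtain ⟨c, hc⟩ := h1
    have hdist : dist (v c) (a i c) = |(v c : ℝ) - a i c| := Int.dist_eq _ _
    rw [hdist] at hc
    have h2 : Real.exp (θ * D) ≤ 2 * Real.cosh (θ * ((v c : ℝ) - a i c)) := by
      rw [← Real.cosh_abs, abs_mul, abs_of_nonneg hθ]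
      have := Real.exp_le_exp.2 (mul_le_mul_of_nonneg_left hc hθ)
      have h3 := Real.exp_pos (-(θ * |(v c : ℝ) - a i c|))
      rw [Real.cosh_eq]
      linarith
    have h3 : 2 * Real.cosh (θ * ((v c : ℝ) - a i c)) ≤
        ∑ c, 2 * Real.cosh (θ * ((v c : ℝ) - a i c)) :=
      Finset.single_le_sum (f := fun c => 2 * Real.cosh (θ * ((v c : ℝ) - a i c)))
        (fun c _ => by positivity) (Finset.mem_univ c)
    calc (1 : ℝ) = Real.exp (-(θ * D)) * Real.exp (θ * D) := by rw [← Real.exp_add]; simp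
      _ ≤ _ := by unfold coshWeight; gcongr; exact h2.trans h3

/-- The distance that `K` particles do not exceed. -/
def reach (d K : ℕ) : ℝ := (K : ℝ) ^ 3 * (K : ℝ) ^ (1 / d : ℝ) / 24

/-- At most `K` particles escape to a distance of order `K ^ (3 + 1 / d)` with a probability that is
exponentially small in `K`. There are `K` rounds; in each of them every particle makes a number of
steps of order `K ^ 4`, hence travels a distance of order `K ^ 2`, so that two given particles are
close to each other with a probability at most of order `K ^ (-2)`. -/
theorem exists_forall_escape_labelled_le (hd : 1 ≤ d) {lam : ℝ} (hlam : 0 < lam) :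
    ∃ K₀ : ℕ, ∀ K ≥ K₀, ∀ (ι : Type) [Fintype ι] [DecidableEq ι], Fintype.card ι ≤ K →
      ∀ (a : ι → Site d) (V : Set (Site d)), (∀ i v, dist v (a i) < reach d K → v ∈ V) →
        escape lam V (labelled ∅ a) ≤ 2 * (1 / 2) ^ K := by
  have hd0 : (0 : ℝ) < d := by exact_mod_cast hd
  have hpos := add_two_mul_pos (d := d) hlam
  obtain ⟨p, hp⟩ : ∃ p, p = lam / (lam + 2 * d) := ⟨_, rfl⟩
  have hp0 : 0 < p := by rw [hp]; positivity
  have hp1 : p < 1 := by rw [hp, div_lt_one hpos]; linarith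
  obtain ⟨A, hA⟩ := exists_nat_ge (16 * d * (1 + 1 / p) ^ 2)
  have hA0 : (0 : ℝ) < A := lt_of_lt_of_le (by positivity) hA
  have hAsqrt : √((d : ℝ) / A) * (1 + 1 / p) ≤ 1 / 4 := by
    refine le_of_sq_le_sq ?_ (by norm_num)
    rw [mul_pow, Real.sq_sqrt (by positivity), div_mul_eq_mul_div, div_le_iff₀ hA0]
    linarith
  set M : ℝ := A / 2 + Real.log 4 + 2 * d with hM
  -- the two conditions on `K`
  have hev1 : ∀ᶠ K : ℕ in Filter.atTop, Real.exp ((1 / (K : ℝ) ^ 2) ^ 2 / 2) ≤ 1 + p / 2 := by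
    have h1 : Filter.Tendsto (fun K : ℕ => Real.exp ((1 / (K : ℝ) ^ 2) ^ 2 / 2)) Filter.atTop
        (nhds (Real.exp ((0 : ℝ) ^ 2 / 2))) := by
      refine (Real.continuous_exp.tendsto _).comp (((Filter.Tendsto.pow ?_ 2)).div_const 2)
      have := (tendsto_inv_atTop_zero (𝕜 := ℝ)).comp
        ((Filter.tendsto_pow_atTop two_ne_zero).comp tendsto_natCast_atTop_atTop)
      simpa [Function.comp_def] using this
    refine h1.eventually (eventually_le_nhds ?_)
    simpa using hp0
  have hev2 : ∀ᶠ K : ℕ in Filter.atTop, 24 * M ≤ (K : ℝ) ^ (1 / d : ℝ) :=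
    ((tendsto_rpow_atTop (by positivity : (0 : ℝ) < 1 / d)).comp
      tendsto_natCast_atTop_atTop).eventually_ge_atTop _
  obtain ⟨K₀, hK₀⟩ := Filter.eventually_atTop.1
    ((hev1.and hev2).and (Filter.eventually_ge_atTop 1))
  refine ⟨K₀, fun K hK ι _ _ hι a V hV => ?_⟩
  obtain ⟨⟨hK1, hK2⟩, hK3⟩ := hK₀ K hK
  have hKpos : (0 : ℝ) < K := by exact_mod_cast hK3
  set θ : ℝ := 1 / (K : ℝ) ^ 2 with hθ
  have hθ0 : 0 < θ := by positivity
  set μ : ℝ := 1 + (Real.cosh θ - 1) / d with hμ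
  have hcosh := Real.one_le_cosh θ
  have hμ1 : 1 ≤ μ := by
    rw [hμ]
    have := div_nonneg (sub_nonneg.2 hcosh) hd0.le
    linarith
  have hμexp : μ ≤ Real.exp (θ ^ 2 / 2) := by
    refine le_trans ?_ (Real.cosh_le_exp_half_sq θ)
    have hd1 : (1 : ℝ) ≤ d := by exact_mod_cast hd
    have := div_le_self (sub_nonneg.2 hcosh) hd1
    rw [hμ]
    linarith
  have hpμ : p + 2 * (1 - p) * μ ≤ 2 := by
    have : μ ≤ 1 + p / 2 := hμexp.trans hK1
    nlinarith
  have hT : (Fintype.card ι : ℝ) ^ 2 * √(d / ((A * K ^ 4 : ℕ) + 1)) * (1 + 1 / p) ≤ 1 / 4 := by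
    refine le_trans ?_ hAsqrt
    gcongr
    have h1 : (K : ℝ) ^ 2 * √(d / ((A * K ^ 4 : ℕ) + 1)) ≤ √((d : ℝ) / A) := by
      rw [← Real.sqrt_sq (by positivity : (0 : ℝ) ≤ (K : ℝ) ^ 2),
        ← Real.sqrt_mul (by positivity)]
      refine Real.sqrt_le_sqrt ?_
      push_cast
      rw [mul_div_assoc', div_le_div_iff₀ (by positivity) hA0]
      nlinarith [mul_pos hd0 hA0]
    refine le_trans ?_ h1
    have : (Fintype.card ι : ℝ) ≤ K := by exact_mod_cast hι
    gcongr
  have hg := isExitWeight_coshWeight hd hθ0.le a hV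
  have main := escape_labelled_rounds hd hlam hp hμ1 hpμ hg hT K a
  refine main.trans ?_
  rw [two_mul ((1 / 2 : ℝ) ^ K)]
  refine add_le_add_right ?_ _
  -- the total weight of the initial positions
  have hw : weightSum (fun i => coshWeight θ (reach d K) (a i)) (fun _ => (2 * μ ^ (A * K ^ 4)) ^ K) a
      = (2 * μ ^ (A * K ^ 4)) ^ K * (Fintype.card ι * (2 * d) * Real.exp (-(θ * reach d K))) := by
    simp [weightSum, coshWeight]
    ring
  rw [hw]
  have hμT : μ ^ (A * K ^ 4) ≤ Real.exp (A / 2) := by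
    refine (pow_le_pow_left₀ (by linarith) hμexp _).trans_eq ?_
    rw [← Real.exp_nat_mul]
    congr 1
    push_cast
    rw [hθ]
    field_simp
  have hθD : θ * reach d K = K * (K : ℝ) ^ (1 / d : ℝ) / 24 := by
    rw [hθ, reach]
    field_simp
  have hcard : (Fintype.card ι : ℝ) * (2 * d) ≤ Real.exp (2 * d * K) := by
    have h1 : (Fintype.card ι : ℝ) ≤ K := by exact_mod_cast hι
    calc (Fintype.card ι : ℝ) * (2 * d) ≤ K * (2 * d) := by gcongr
      _ ≤ 2 * d * K + 1 := by linarith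
      _ ≤ _ := Real.add_one_le_exp _
  calc (2 * μ ^ (A * K ^ 4)) ^ K * (Fintype.card ι * (2 * d) * Real.exp (-(θ * reach d K)))
      ≤ (2 * Real.exp (A / 2)) ^ K *
          (Real.exp (2 * d * K) * Real.exp (-(θ * reach d K))) := by gcongr
    _ = (1 / 2) ^ K * Real.exp (K * M - θ * reach d K) := by
        have : (2 * Real.exp (A / 2)) = 1 / 2 * Real.exp (A / 2 + Real.log 4) := by
          rw [Real.exp_add, Real.exp_log (by norm_num)]; ring
        rw [this, mul_pow, ← Real.exp_nat_mul, mul_assoc, ← Real.exp_add, ← Real.exp_add, hM]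
        congr 2
        ring
    _ ≤ (1 / 2) ^ K * 1 := by
        gcongr
        rw [Real.exp_le_one_iff, hθD, sub_nonpos]
        nlinarith
    _ = (1 / 2) ^ K := mul_one _

end Few

/-! ### Decomposition into clusters -/

section Clusters

variable {d : ℕ} {lam : ℝ}

/-- The points at distance less than `D` from a finite set. -/
def thicken (P : Finset (Site d)) (D : ℝ) : Set (Site d) := {v | ∃ y ∈ P, dist v y < D}

/-- In a finite set with fewer than `K` particles in each ball of radius `K * r`, some nonempty part
with fewer than `K` particles is at distance more than `r` from the rest. Otherwise the part
reached from a given point in `K` steps of length at most `r` would have at least `K` points. -/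
theorem exists_isolated_cluster {P : Finset (Site d)} (hP : P.Nonempty) {m : Site d → ℕ}
    (hm : ∀ y ∈ P, 1 ≤ m y) {r : ℝ} (hr : 0 ≤ r) {K : ℕ}
    (hK : ∀ a ∈ P, ∑ y ∈ P with dist y a ≤ K * r, m y < K) :
    ∃ c ⊆ P, c.Nonempty ∧ ∑ y ∈ c, m y < K ∧ ∀ b ∈ P, ∀ a ∈ c, dist b a ≤ r → b ∈ c := by
  classical
  obtain ⟨a, ha⟩ := hP
  have key : ∀ n : ℕ, (∃ c ⊆ P, c.Nonempty ∧ (∀ y ∈ c, dist y a ≤ n * r) ∧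
      ∀ b ∈ P, ∀ a' ∈ c, dist b a' ≤ r → b ∈ c) ∨
      ∃ c ⊆ P, c.Nonempty ∧ (∀ y ∈ c, dist y a ≤ n * r) ∧ n + 1 ≤ c.card := by
    intro n
    induction n with
    | zero => exact Or.inr ⟨{a}, by simpa using ha, by simp, by simp, by simp⟩
    | succ n ih =>
      have hn : (n : ℝ) * r ≤ ((n + 1 : ℕ) : ℝ) * r := by
        push_cast
        nlinarith
      rcases ih with ⟨c, hcP, hne, hcr, hcl⟩ | ⟨c, hcP, hne, hcr, hcard⟩
      · exact Or.inl ⟨c, hcP, hne, fun y hy => (hcr y hy).trans hn, hcl⟩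
      · by_cases hcl : ∀ b ∈ P, ∀ a' ∈ c, dist b a' ≤ r → b ∈ c
        · exact Or.inl ⟨c, hcP, hne, fun y hy => (hcr y hy).trans hn, hcl⟩
        · push Not at hcl
          obtain ⟨b, hb, a', ha', hba, hbc⟩ := hcl
          refine Or.inr ⟨insert b c, Finset.insert_subset hb hcP, Finset.insert_nonempty _ _, ?_, ?_⟩
          · intro y hy
            rcases Finset.mem_insert.1 hy with rfl | hy
            · have := dist_triangle y a' a
              have := hcr a' ha'
              push_cast
              linarith
            · exact (hcr y hy).trans hn
          · rw [Finset.card_insert_of_notMem hbc]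
            omega
  have hsub : ∀ c ⊆ P, (∀ y ∈ c, dist y a ≤ K * r) → ∑ y ∈ c, m y < K := fun c hcP hcr =>
    lt_of_le_of_lt (Finset.sum_le_sum_of_subset fun y hy =>
      Finset.mem_filter.2 ⟨hcP hy, hcr y hy⟩) (hK a ha)
  rcases key K with ⟨c, hcP, hne, hcr, hcl⟩ | ⟨c, hcP, hne, hcr, hcard⟩
  · exact ⟨c, hcP, hne, hsub c hcP hcr, hcl⟩
  · have h1 := hsub c hcP hcr
    have h2 : c.card ≤ ∑ y ∈ c, m y := by
      rw [Finset.card_eq_sum_ones]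
      exact Finset.sum_le_sum fun y hy => hm y (hcP hy)
    omega

/-- A configuration without sleeping particles is given by labelled particles. -/
theorem exists_labelled_eq {η : Config d} (hη : ∀ y, η y ≠ SiteState.sleeping) :
    labelled ∅ (fun k : (y : η.support) × Fin (η y).numActive => (k.1 : Site d)) = η := by
  classical
  ext y
  rw [labelled_of_forall_ne (by simp)]
  have h : labelCount (fun k : (y : η.support) × Fin (η y).numActive => (k.1 : Site d)) y =
      (η y).numActive := by
    rw [labelCount, Finset.card_filter, Fintype.sum_sigma]
    have hsum : ∀ x : η.support, (∑ _k : Fin (η x).numActive, if (x : Site d) = y then 1 else 0) =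
        if (x : Site d) = y then (η x).numActive else 0 := fun x => by split_ifs <;> simp
    rw [Finset.sum_congr rfl fun x _ => hsum x]
    rw [Finset.sum_coe_sort η.support (fun z => if z = y then (η z).numActive else 0),
      Finset.sum_ite_eq']
    split_ifs with hy
    · rfl
    · rw [Finsupp.notMem_support_iff.1 hy]; rfl
  rw [h]
  cases hs : η y with
  | sleeping => exact absurd hs (hη y)
  | active n => rfl

/-- If every group of at most `K` particles stays within distance `D` with probability at least
`1 - δ`, then the same holds for a configuration with fewer than `K` particles in each ball of
radius `2 K D`, up to a factor that is the number of occupied sites. -/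
theorem escape_thicken_le (hlam : 0 < lam) {K : ℕ} {D δ : ℝ} (hD : 0 < D)
    (hδ : ∀ (ι : Type) [Fintype ι] [DecidableEq ι], Fintype.card ι ≤ K →
      ∀ (a : ι → Site d) (V : Set (Site d)), (∀ i v, dist v (a i) < D → v ∈ V) →
        escape lam V (labelled ∅ a) ≤ δ)
    (η : Config d) (hη : ∀ y, η y ≠ SiteState.sleeping)
    (hK : ∀ a ∈ η.support, ∑ y ∈ η.support with dist y a ≤ K * (2 * D), (η y).numActive < K) :
    escape lam (thicken η.support D) η ≤ η.support.card * δ := by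
  classical
  obtain ⟨N, hN⟩ : ∃ N, N = η.support.card := ⟨_, rfl⟩
  induction N using Nat.strong_induction_on generalizing η with
  | _ N ih =>
  rcases η.support.eq_empty_or_nonempty with h0 | hne
  · have h0' : η = 0 := Finsupp.support_eq_empty.1 h0
    rw [h0, Finset.card_empty, Nat.cast_zero, zero_mul]
    refine (escape_eq_zero hlam (fun x _ => by rw [h0']; rfl) fun x => by rw [h0']; rfl).le
  have hm : ∀ y ∈ η.support, 1 ≤ (η y).numActive := fun y hy => by
    rw [Finsupp.mem_support_iff] at hy
    cases hs : η y with
    | sleeping => exact absurd hs (hη y)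
    | active n =>
      rw [hs] at hy
      rw [Nat.one_le_iff_ne_zero]
      rintro h
      simp only [SiteState.numActive] at h
      exact hy (by rw [h]; rfl)
  obtain ⟨c, hcP, hcne, hcK, hcl⟩ := exists_isolated_cluster hne hm (by positivity) hK
  set V := thicken c D with hV
  set W := thicken (η.support \ c) D with hW
  have hVW : Disjoint V W := by
    rw [Set.disjoint_left]
    rintro v ⟨a, ha, hva⟩ ⟨b, hb, hvb⟩
    obtain ⟨hb1, hb2⟩ := Finset.mem_sdiff.1 hb
    refine hb2 (hcl b hb1 a ha ?_)
    have := dist_triangle_left b a v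
    linarith
  have hcV : ∀ y ∈ c, y ∈ V := fun y hy => ⟨y, hy, by simpa using hD⟩
  have hcW : ∀ y ∈ η.support \ c, y ∈ W := fun y hy => ⟨y, hy, by simpa using hD⟩
  have hunion : thicken η.support D = V ∪ W := by
    ext v
    constructor
    · rintro ⟨y, hy, hvy⟩
      by_cases hyc : y ∈ c
      · exact Or.inl ⟨y, hyc, hvy⟩
      · exact Or.inr ⟨y, Finset.mem_sdiff.2 ⟨hy, hyc⟩, hvy⟩
    · rintro (⟨y, hy, hvy⟩ | ⟨y, hy, hvy⟩)
      · exact ⟨y, hcP hy, hvy⟩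
      · exact ⟨y, (Finset.mem_sdiff.1 hy).1, hvy⟩
  have hsV : (restrictTo V η).support = c := by
    ext y
    rw [Finsupp.mem_support_iff]
    by_cases hyV : y ∈ V
    · rw [restrictTo_of_mem hyV, ← Finsupp.mem_support_iff]
      refine ⟨fun h => ?_, fun h => hcP h⟩
      by_contra hyc
      exact hVW.notMem_of_mem_left hyV (hcW y (Finset.mem_sdiff.2 ⟨h, hyc⟩))
    · rw [restrictTo_of_notMem hyV]
      exact ⟨fun h => absurd rfl h, fun h => absurd (hcV y h) hyV⟩
  have hsW : (restrictTo W η).support = η.support \ c := by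
    ext y
    rw [Finsupp.mem_support_iff]
    by_cases hyW : y ∈ W
    · rw [restrictTo_of_mem hyW, ← Finsupp.mem_support_iff, Finset.mem_sdiff]
      exact ⟨fun h => ⟨h, fun hyc => hVW.notMem_of_mem_right hyW (hcV y hyc)⟩, fun h => h.1⟩
    · rw [restrictTo_of_notMem hyW]
      exact ⟨fun h => absurd rfl h, fun h => absurd (hcW y h) hyW⟩
  have hns : ∀ (U : Set (Site d)) (y : Site d), restrictTo U η y ≠ SiteState.sleeping := by
    intro U y
    by_cases hyU : y ∈ U
    · rw [restrictTo_of_mem hyU]; exact hη y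
    · rw [restrictTo_of_notMem hyU]; intro h; cases h
  have h1 : escape lam V (restrictTo V η) ≤ δ := by
    rw [← exists_labelled_eq (hns V)]
    refine hδ _ ?_ _ _ ?_
    · rw [Fintype.card_sigma]
      simp only [Fintype.card_fin]
      rw [Finset.sum_coe_sort (restrictTo V η).support (fun y => (restrictTo V η y).numActive), hsV]
      refine le_trans (Finset.sum_le_sum fun y hy => ?_) hcK.le
      rw [restrictTo_of_mem (hcV y hy)]
    · intro i v hv
      exact ⟨i.1, hsV ▸ i.1.2, hv⟩
  have h2 : escape lam W (restrictTo W η) ≤ ((η.support \ c).card : ℝ) * δ := by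
    have hlt : (η.support \ c).card < N := by
      rw [hN]
      exact Finset.card_lt_card (Finset.sdiff_ssubset hcP hcne)
    have := ih _ (hsW ▸ hlt) (restrictTo W η) (hns W) (fun a ha => ?_) rfl
    · rwa [hsW] at this
    · rw [hsW] at ha ⊢
      refine lt_of_le_of_lt ?_ (hK a (Finset.mem_sdiff.1 ha).1)
      calc _ ≤ ∑ y ∈ η.support \ c with dist y a ≤ K * (2 * D), (η y).numActive := by
            refine Finset.sum_le_sum fun y hy => ?_
            rw [restrictTo_of_mem (hcW y (Finset.mem_filter.1 hy).1)]
        _ ≤ _ := Finset.sum_le_sum_of_subset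
            (Finset.filter_subset_filter _ Finset.sdiff_subset)
  have hδ0 : 0 ≤ δ := (escape_nonneg hlam).trans h1
  have hcard : ((η.support \ c).card : ℝ) + 1 ≤ η.support.card := by
    have := Finset.card_lt_card (Finset.sdiff_ssubset hcP hcne)
    exact_mod_cast this
  rw [hunion]
  refine (escape_union_le hlam hVW fun x hx => ?_).trans ?_
  · rw [← hunion]
    exact ⟨x, Finsupp.mem_support_iff.2 hx, by simpa using hD⟩
  · calc _ ≤ δ + ((η.support \ c).card : ℝ) * δ := add_le_add h1 h2
      _ = (((η.support \ c).card : ℝ) + 1) * δ := by ring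
      _ ≤ _ := by gcongr

end Clusters

/-! ### Poisson initial condition -/

section Poisson

variable {d : ℕ} {lam : ℝ}

theorem lintegral_exp_poissonMeasure (ρ : ℝ≥0) :
    ∫⁻ n : ℕ, ENNReal.ofReal (Real.exp n) ∂(poissonMeasure ρ) =
      ENNReal.ofReal (Real.exp (ρ * (Real.exp 1 - 1))) := by
  have h1 : ∀ n : ℕ, ENNReal.ofReal (Real.exp n) * poissonMeasure ρ {n} =
      ENNReal.ofReal (Real.exp (-ρ) * ((ρ * Real.exp 1) ^ n / n.factorial)) := fun n => by
    rw [poissonMeasure_singleton, ← ENNReal.ofReal_mul (Real.exp_pos _).le, mul_pow,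
      ← Real.exp_nat_mul, mul_one]
    congr 1
    ring
  have h2 : HasSum (fun n : ℕ => Real.exp (-ρ) * ((ρ * Real.exp 1) ^ n / n.factorial))
      (Real.exp (-ρ) * Real.exp (ρ * Real.exp 1)) := by
    rw [Real.exp_eq_exp_ℝ]
    exact (NormedSpace.expSeries_div_hasSum_exp (ρ * NormedSpace.exp (1 : ℝ) : ℝ)).mul_left _
  rw [lintegral_countable']
  simp only [h1]
  rw [← ENNReal.ofReal_tsum_of_nonneg (fun n => by positivity) h2.summable, h2.tsum_eq,
    ← Real.exp_add]
  congr 2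
  ring

/-- A Chernoff bound for sums of independent Poisson variables. -/
theorem poisson_sum_ge_le {ι : Type*} [Fintype ι] (ρ : ℝ≥0) (s : Finset ι) (K : ℕ) :
    (Measure.pi fun _ : ι => poissonMeasure ρ) {n | K ≤ ∑ i ∈ s, n i} ≤
      ENNReal.ofReal (Real.exp (2 * ρ * s.card - K)) := by
  have hm : ∀ i : ι, Measurable fun n : ι → ℕ => ENNReal.ofReal (Real.exp (n i)) := fun i =>
    (Measurable.of_discrete (f := fun k : ℕ => ENNReal.ofReal (Real.exp k))).comp
      (measurable_pi_apply i)
  have hind := iIndepFun_pi (μ := fun _ : ι => poissonMeasure ρ)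
    (X := fun _ => fun k : ℕ => ENNReal.ofReal (Real.exp k))
    fun _ => Measurable.of_discrete.aemeasurable
  have hint : ∫⁻ n : ι → ℕ, ∏ i ∈ s, ENNReal.ofReal (Real.exp (n i))
      ∂(Measure.pi fun _ : ι => poissonMeasure ρ) ≤ ENNReal.ofReal (Real.exp (2 * ρ * s.card)) := by
    rw [lintegral_prod_eq_prod_lintegral_of_indepFun s _ hind hm]
    have h1 : ∀ i : ι, ∫⁻ n : ι → ℕ, ENNReal.ofReal (Real.exp (n i))
        ∂(Measure.pi fun _ : ι => poissonMeasure ρ) =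
        ENNReal.ofReal (Real.exp (ρ * (Real.exp 1 - 1))) := fun i => by
      rw [← lintegral_exp_poissonMeasure]
      exact (measurePreserving_eval (fun _ : ι => poissonMeasure ρ) i).lintegral_comp
        (Measurable.of_discrete (f := fun k : ℕ => ENNReal.ofReal (Real.exp k)))
    rw [Finset.prod_congr rfl fun i _ => h1 i, Finset.prod_const,
      ← ENNReal.ofReal_pow (Real.exp_pos _).le, ← Real.exp_nat_mul]
    refine ENNReal.ofReal_le_ofReal (Real.exp_le_exp.2 ?_)
    have he : Real.exp 1 - 1 ≤ 2 := by linarith [Real.exp_one_lt_d9]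
    have : (0 : ℝ) ≤ s.card * ρ := by positivity
    nlinarith
  have hsub : {n : ι → ℕ | K ≤ ∑ i ∈ s, n i} ⊆
      {n | ENNReal.ofReal (Real.exp K) ≤ ∏ i ∈ s, ENNReal.ofReal (Real.exp (n i))} := by
    intro n hn
    simp only [Set.mem_ofPred_eq] at hn ⊢
    rw [← ENNReal.ofReal_prod_of_nonneg fun i _ => (Real.exp_pos _).le, ← Real.exp_sum]
    refine ENNReal.ofReal_le_ofReal (Real.exp_le_exp.2 ?_)
    exact_mod_cast hn
  have hmark := (mul_meas_ge_le_lintegral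
    (Finset.measurable_prod s fun i _ => hm i) (ENNReal.ofReal (Real.exp K))).trans hint
  have hne : ENNReal.ofReal (Real.exp K) ≠ 0 := by simp [Real.exp_pos]
  calc _ ≤ (Measure.pi fun _ : ι => poissonMeasure ρ)
        {n | ENNReal.ofReal (Real.exp K) ≤ ∏ i ∈ s, ENNReal.ofReal (Real.exp (n i))} :=
        measure_mono hsub
    _ ≤ ENNReal.ofReal (Real.exp (2 * ρ * s.card)) / ENNReal.ofReal (Real.exp K) := by
        rw [ENNReal.le_div_iff_mul_le (Or.inl hne) (Or.inl ENNReal.ofReal_ne_top), mul_comm]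
        exact hmark
    _ = _ := by
        rw [← ENNReal.ofReal_div_of_pos (Real.exp_pos _), ← Real.exp_sub]

theorem card_filter_dist_le (B : Finset (Site d)) (a : Site d) {s : ℝ} (hs : 0 ≤ s) :
    ((B.filter fun y => dist y a ≤ s).card : ℝ) ≤ (2 * s + 1) ^ d := by
  have hsub : (B.filter fun y => dist y a ≤ s) ⊆
      Fintype.piFinset fun c => Finset.Icc (a c - ⌊s⌋) (a c + ⌊s⌋) := by
    intro y hy
    rw [Fintype.mem_piFinset]
    intro c
    have h1 := (dist_le_pi_dist y a c).trans (Finset.mem_filter.1 hy).2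
    rw [Int.dist_eq, ← Int.cast_sub, ← Int.cast_abs] at h1
    have h2 := abs_le.1 (Int.le_floor.2 h1)
    rw [Finset.mem_Icc]
    constructor <;> linarith [h2.1, h2.2]
  calc ((B.filter fun y => dist y a ≤ s).card : ℝ)
      ≤ ((Fintype.piFinset fun c => Finset.Icc (a c - ⌊s⌋) (a c + ⌊s⌋)).card : ℝ) := by
        exact_mod_cast Finset.card_le_card hsub
    _ = (2 * ⌊s⌋ + 1 : ℝ) ^ d := by
        have hf : 0 ≤ ⌊s⌋ := Int.floor_nonneg.2 hs
        have : ∀ c : Fin d, (a c + ⌊s⌋ + 1 - (a c - ⌊s⌋)).toNat = (2 * ⌊s⌋ + 1).toNat := fun c => by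
          congr 1; ring
        simp only [Fintype.card_piFinset, Int.card_Icc, this, Finset.prod_const, Finset.card_univ,
          Fintype.card_fin]
        push_cast
        congr 1
        have h3 : ((2 * ⌊s⌋ + 1).toNat : ℤ) = 2 * ⌊s⌋ + 1 := Int.toNat_of_nonneg (by positivity)
        exact_mod_cast h3
    _ ≤ _ := by gcongr; exact Int.floor_le s

theorem ofCounts_apply_of_mem {B : Finset (Site d)} (n : B → ℕ) {y : Site d} (h : y ∈ B) :
    ofCounts B n y = SiteState.active (n ⟨y, h⟩) := by
  simp [ofCounts, h]

theorem ofCounts_apply_of_notMem {B : Finset (Site d)} (n : B → ℕ) {y : Site d} (h : y ∉ B) :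
    ofCounts B n y = 0 := by
  simp [ofCounts, h]

/-- With a Poisson initial condition, the escape probability is small because with high probability
no ball of radius `2 K D` contains `K` particles. -/
theorem lintegral_escape_poissonConfig_le (hlam : 0 < lam) {K : ℕ} {D δ : ℝ} (hD : 0 < D)
    (hδ0 : 0 ≤ δ)
    (hδ : ∀ (ι : Type) [Fintype ι] [DecidableEq ι], Fintype.card ι ≤ K →
      ∀ (a : ι → Site d) (V : Set (Site d)), (∀ i v, dist v (a i) < D → v ∈ V) →
        escape lam V (labelled ∅ a) ≤ δ)
    (B : Finset (Site d)) (ρ : ℝ≥0) (hρ : 2 * ρ * (2 * (K * (2 * D)) + 1) ^ d ≤ (K : ℝ) / 2) :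
    ∫⁻ η, ENNReal.ofReal (escape lam (thicken B D) η) ∂(poissonConfig B ρ) ≤
      ENNReal.ofReal (B.card * (δ + Real.exp (-(K / 2)))) := by
  classical
  let S : B → Finset B := fun a => Finset.univ.filter fun y => dist (y : Site d) a ≤ K * (2 * D)
  let bad : Set (B → ℕ) := ⋃ a, {n | K ≤ ∑ y ∈ S a, n y}
  have hSm : ∀ a : B, MeasurableSet {n : B → ℕ | K ≤ ∑ y ∈ S a, n y} := fun a =>
    measurableSet_le measurable_const
      (Finset.measurable_fun_sum _ fun y _ => measurable_pi_apply y)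
  have hbadm : MeasurableSet bad := MeasurableSet.iUnion hSm
  have hScard : ∀ a : B, ((S a).card : ℝ) ≤ (2 * (K * (2 * D)) + 1) ^ d := fun a => by
    refine le_trans ?_ (card_filter_dist_le B (a : Site d) (by positivity : 0 ≤ K * (2 * D)))
    rw [Nat.cast_le]
    refine Finset.card_le_card_of_injOn (fun y => (y : Site d)) (fun y hy => ?_)
      (fun _ _ _ _ h => Subtype.ext h)
    simp only [S, Finset.coe_filter, Set.mem_ofPred_eq, Finset.mem_univ, true_and] at hy ⊢
    exact ⟨y.2, hy⟩
  have hbadP : (Measure.pi fun _ : B => poissonMeasure ρ) bad ≤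
      ENNReal.ofReal (B.card * Real.exp (-(K / 2))) := by
    calc _ ≤ ∑ a : B, (Measure.pi fun _ : B => poissonMeasure ρ) {n | K ≤ ∑ y ∈ S a, n y} :=
          measure_iUnion_fintype_le _ _
      _ ≤ ∑ _a : B, ENNReal.ofReal (Real.exp (-(K / 2))) := by
          refine Finset.sum_le_sum fun a _ => (poisson_sum_ge_le ρ (S a) K).trans ?_
          refine ENNReal.ofReal_le_ofReal (Real.exp_le_exp.2 ?_)
          have := mul_le_mul_of_nonneg_left (hScard a) (by positivity : (0 : ℝ) ≤ 2 * ρ)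
          linarith
      _ = _ := by
          rw [Finset.sum_const, Finset.card_univ, Fintype.card_coe, nsmul_eq_mul,
            ENNReal.ofReal_mul (by positivity), ENNReal.ofReal_natCast]
  have hgood : ∀ n : B → ℕ, n ∉ bad → escape lam (thicken B D) (ofCounts B n) ≤ B.card * δ := by
    intro n hn
    set η := ofCounts B n with hη
    have hsupp : η.support ⊆ B := fun y hy => by
      by_contra h
      exact Finsupp.mem_support_iff.1 hy (ofCounts_apply_of_notMem n h)
    have hns : ∀ y, η y ≠ SiteState.sleeping := fun y => by
      by_cases h : y ∈ B
      · rw [hη, ofCounts_apply_of_mem n h]; intro h; cases h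
      · rw [hη, ofCounts_apply_of_notMem n h]; intro h; cases h
    have hK : ∀ a ∈ η.support, ∑ y ∈ η.support with dist y a ≤ K * (2 * D),
        (η y).numActive < K := by
      intro a ha
      have ha' : ¬ K ≤ ∑ y ∈ S ⟨a, hsupp ha⟩, n y := fun h => hn (Set.mem_iUnion.2 ⟨_, h⟩)
      refine lt_of_le_of_lt ?_ (not_le.1 ha')
      calc ∑ y ∈ η.support with dist y a ≤ K * (2 * D), (η y).numActive
          ≤ ∑ y ∈ B with dist y a ≤ K * (2 * D), (η y).numActive :=
            Finset.sum_le_sum_of_subset (Finset.filter_subset_filter _ hsupp)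
        _ = ∑ y : B, if dist (y : Site d) a ≤ K * (2 * D) then (η y).numActive else 0 := by
            rw [Finset.sum_filter]
            exact (Finset.sum_coe_sort B
              (fun y => if dist y a ≤ K * (2 * D) then (η y).numActive else 0)).symm
        _ = ∑ y ∈ S ⟨a, hsupp ha⟩, n y := by
            rw [Finset.sum_filter]
            refine Finset.sum_congr rfl fun y _ => ?_
            rw [hη, ofCounts_apply_of_mem n y.2]
            rfl
    calc escape lam (thicken B D) η ≤ escape lam (thicken η.support D) η :=
          escape_anti hlam fun v ⟨y, hy, hvy⟩ => ⟨y, hsupp hy, hvy⟩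
      _ ≤ η.support.card * δ := escape_thicken_le hlam hD hδ η hns hK
      _ ≤ B.card * δ := by
          have : η.support.card ≤ B.card := Finset.card_le_card hsupp
          gcongr
  rw [poissonConfig, lintegral_map Measurable.of_discrete Measurable.of_discrete]
  calc ∫⁻ n, ENNReal.ofReal (escape lam (thicken B D) (ofCounts B n))
        ∂(Measure.pi fun _ : B => poissonMeasure ρ)
      ≤ ∫⁻ n, (ENNReal.ofReal (B.card * δ) + bad.indicator 1 n)
        ∂(Measure.pi fun _ : B => poissonMeasure ρ) := by
        refine lintegral_mono fun n => ?_
        by_cases hn : n ∈ bad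
        · rw [Set.indicator_of_mem hn, Pi.one_apply]
          refine le_add_left ?_
          rw [ENNReal.ofReal_le_one]
          exact escape_le_one hlam
        · rw [Set.indicator_of_notMem hn, add_zero]
          exact ENNReal.ofReal_le_ofReal (hgood n hn)
    _ = ENNReal.ofReal (B.card * δ) + (Measure.pi fun _ : B => poissonMeasure ρ) bad := by
        rw [lintegral_add_left measurable_const, lintegral_indicator_one hbadm]
        simp
    _ ≤ ENNReal.ofReal (B.card * δ) + ENNReal.ofReal (B.card * Real.exp (-(K / 2))) := by
        gcongr
    _ = _ := by
        rw [← ENNReal.ofReal_add (by positivity) (by positivity), mul_add]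

end Poisson

/-! ### The choice of the scales -/

section Scales

variable {d : ℕ}

theorem card_latticeBox_le {R L : ℝ} (hR : 0 ≤ R) (hL : 1 ≤ L) :
    ((latticeBox d R (L - R)).card : ℝ) ≤ (2 * L) ^ d := by
  rw [latticeBox, Fintype.card_piFinset, Finset.prod_const, Finset.card_univ, Fintype.card_fin,
    Nat.cast_pow, Int.card_Ico]
  gcongr
  have h1 : ⌈L - R⌉ - ⌈R⌉ ≤ ⌈L⌉ := by
    have := Int.ceil_mono (by linarith : L - R ≤ L)
    have := Int.ceil_nonneg hR
    linarith
  have h2 : ((⌈L - R⌉ - ⌈R⌉).toNat : ℤ) ≤ ⌈L⌉ := by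
    have := Int.ceil_nonneg (by linarith : 0 ≤ L)
    omega
  have h3 : ((⌈L - R⌉ - ⌈R⌉).toNat : ℝ) ≤ ⌈L⌉ := by exact_mod_cast h2
  have := Int.ceil_lt_add_one L
  linarith

theorem disjoint_innerBoundary_thicken {R L D : ℝ} (hD : D + 2 ≤ R) :
    Disjoint (innerBoundary (latticeBox d 0 L : Set (Site d)))
      (thicken (latticeBox d R (L - R)) D) := by
  rw [Set.disjoint_left]
  rintro x ⟨-, hx⟩ ⟨y, hy, hxy⟩
  have hne : ((latticeBox d 0 L : Set (Site d))ᶜ).Nonempty := by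
    rw [Set.nonempty_iff_ne_empty]
    intro h
    rw [h, Metric.infDist_empty] at hx
    exact zero_ne_one hx
  obtain ⟨z, hz, hxz⟩ := (Metric.infDist_lt_iff hne).1 (hx.trans_lt one_lt_two)
  have hyz : dist y z < R := by
    have := dist_triangle_left y z x
    linarith
  refine hz (mem_latticeBox.2 fun c => ?_)
  have h1 := (dist_le_pi_dist y z c).trans_lt hyz
  rw [Int.dist_eq, abs_lt] at h1
  have h2 := mem_latticeBox.1 hy c
  constructor <;> linarith

theorem reach_pos {K : ℕ} (hK : 1 ≤ K) : 0 < reach d K := by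
  have : (0 : ℝ) < K := by exact_mod_cast hK
  unfold reach
  positivity

theorem reach_le (hd : 1 ≤ d) {K : ℕ} (hK : 1 ≤ K) : reach d K ≤ (K : ℝ) ^ 4 / 24 := by
  have h1 : (1 : ℝ) ≤ K := by exact_mod_cast hK
  have h2 : (K : ℝ) ^ (1 / d : ℝ) ≤ K := by
    calc (K : ℝ) ^ (1 / d : ℝ) ≤ (K : ℝ) ^ (1 : ℝ) := by
          refine Real.rpow_le_rpow_of_exponent_le h1 ?_
          rw [div_le_one (by exact_mod_cast hd)]
          exact_mod_cast hd
      _ = K := Real.rpow_one _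
  unfold reach
  gcongr
  calc (K : ℝ) ^ 3 * (K : ℝ) ^ (1 / d : ℝ) ≤ (K : ℝ) ^ 3 * K := by gcongr
    _ = (K : ℝ) ^ 4 := by ring

theorem pow_reach_le (hd : 1 ≤ d) {K : ℕ} (hK : 2 ≤ K) :
    (2 * (K * (2 * reach d K)) + 1) ^ d ≤ (K : ℝ) ^ (4 * d) * K / 4 := by
  have h1 : (2 : ℝ) ≤ K := by exact_mod_cast hK
  have hK0 : (0 : ℝ) < K := by linarith
  have hd0 : (0 : ℝ) < d := by exact_mod_cast hd
  have hroot : 1 ≤ (K : ℝ) ^ (1 / d : ℝ) := Real.one_le_rpow (by linarith) (by positivity)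
  have h4 : (16 : ℝ) ≤ (K : ℝ) ^ 4 := by
    calc (16 : ℝ) = 2 ^ 4 := by norm_num
      _ ≤ _ := by gcongr
  have hr : 0 < reach d K := reach_pos (by omega)
  have h5 : 2 * (K * (2 * reach d K)) + 1 ≤ (K : ℝ) ^ 4 * (K : ℝ) ^ (1 / d : ℝ) / 4 := by
    have : 2 * (K * (2 * reach d K)) = (K : ℝ) ^ 4 * (K : ℝ) ^ (1 / d : ℝ) / 6 := by
      unfold reach; ring
    rw [this]
    nlinarith
  calc (2 * (K * (2 * reach d K)) + 1) ^ d
      ≤ ((K : ℝ) ^ 4 * (K : ℝ) ^ (1 / d : ℝ) / 4) ^ d := by gcongr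
    _ = (K : ℝ) ^ (4 * d) * K / 4 ^ d := by
        rw [div_pow, mul_pow, ← pow_mul, ← Real.rpow_natCast ((K : ℝ) ^ (1 / d : ℝ)),
          ← Real.rpow_mul hK0.le, one_div_mul_cancel hd0.ne', Real.rpow_one]
    _ ≤ _ := by
        gcongr
        calc (4 : ℝ) = 4 ^ 1 := by norm_num
          _ ≤ 4 ^ d := pow_le_pow_right₀ (by norm_num) hd

theorem rpow_le_exp {u s : ℝ} (hu : 1 ≤ u) :
    u ^ s ≤ 4 ^ ⌈s⌉₊ * ⌈s⌉₊.factorial * Real.exp (u / 4) := by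
  have h := Real.pow_div_factorial_le_exp (u / 4) (by positivity) ⌈s⌉₊
  rw [div_le_iff₀ (by positivity), div_pow, div_le_iff₀ (by positivity)] at h
  calc u ^ s ≤ u ^ ((⌈s⌉₊ : ℕ) : ℝ) := Real.rpow_le_rpow_of_exponent_le hu (Nat.le_ceil s)
    _ = u ^ ⌈s⌉₊ := Real.rpow_natCast _ _
    _ ≤ _ := by linarith

end Scales

end ARW

end

theorem theoremt (d : ℕ) (hd : 1 ≤ d) (lam : ℝ) (hlam : 0 < lam) :
    ∃ c : ℝ, 0 < c ∧ ∀ ε : ℝ, 0 < ε → ∃ C : ℝ, 0 < C ∧ ∀ L : ℝ, 1 ≤ L →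
      ARW.law lam
          (ARW.poissonConfig (ARW.latticeBox d (L ^ ε) (L - L ^ ε)) (Real.toNNReal (L ^ (-ε))))
          {ω | ∃ t : ℝ≥0, ∃ x ∈ ARW.innerBoundary (ARW.latticeBox d 0 L : Set (ARW.Site d)),
            ARW.path lam ω t x ≠ 0}
        ≤ ENNReal.ofReal (C * Real.exp (-c * L ^ (ε / (4 * d)))) := by
  obtain ⟨K₀, hK₀⟩ := ARW.exists_forall_escape_labelled_le hd hlam
  have hd0 : (0 : ℝ) < d := by exact_mod_cast hd
  refine ⟨1 / 4, by norm_num, fun ε hε => ?_⟩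
  obtain ⟨K₁, hK₁⟩ : ∃ K₁, K₁ = max K₀ 2 := ⟨_, rfl⟩
  set s : ℝ := 4 * d / ε * d with hs
  set C' : ℝ := 2 ^ d * (4 ^ ⌈s⌉₊ * ⌈s⌉₊.factorial) * (3 * Real.exp (1 / 2)) with hC'
  have hC'0 : 0 < C' := by positivity
  refine ⟨Real.exp (K₁ / 4) + C', by positivity, fun L hL => ?_⟩
  have hL0 : 0 < L := by linarith
  set u : ℝ := L ^ (ε / (4 * d)) with hu
  have hu1 : 1 ≤ u := Real.one_le_rpow hL (by positivity)
  by_cases hsmall : u < K₁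
  · -- the claimed bound exceeds one
    refine prob_le_one.trans ?_
    rw [ENNReal.one_le_ofReal]
    calc (1 : ℝ) ≤ Real.exp (K₁ / 4) * Real.exp (-(1 / 4) * u) := by
          rw [← Real.exp_add]
          exact Real.one_le_exp (by linarith)
      _ ≤ _ := by gcongr; linarith
  push Not at hsmall
  set K := ⌊u⌋₊ with hK
  have hKK₁ : K₁ ≤ K := Nat.le_floor hsmall
  have hK2 : 2 ≤ K := (le_max_right K₀ 2).trans (hK₁ ▸ hKK₁)
  have hKK₀ : K₀ ≤ K := (le_max_left K₀ 2).trans (hK₁ ▸ hKK₁)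
  have hKu : (K : ℝ) ≤ u := Nat.floor_le (by linarith)
  have huK : u < K + 1 := Nat.lt_floor_add_one u
  have hKpos : (0 : ℝ) < K := by exact_mod_cast (by omega : 0 < K)
  set R : ℝ := L ^ ε with hR
  have hR0 : 0 < R := by positivity
  have hKR : (K : ℝ) ^ (4 * d) ≤ R := by
    calc (K : ℝ) ^ (4 * d) ≤ u ^ (4 * d) := by gcongr
      _ = R := by
        rw [hu, hR, ← Real.rpow_natCast, ← Real.rpow_mul hL0.le]
        congr 1
        push_cast
        field_simp
  have hK4 : (K : ℝ) ^ 4 ≤ R := by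
    refine le_trans (pow_le_pow_right₀ ?_ (by omega)) hKR
    exact_mod_cast (by omega : 1 ≤ K)
  have h16 : (16 : ℝ) ≤ (K : ℝ) ^ 4 := by
    calc (16 : ℝ) = (2 : ℝ) ^ 4 := by norm_num
      _ ≤ _ := by gcongr; exact_mod_cast hK2
  have hreach := ARW.reach_le hd (K := K) (by omega)
  have hρ : (2 * (Real.toNNReal (L ^ (-ε)) : ℝ) *
      (2 * (K * (2 * ARW.reach d K)) + 1) ^ d) ≤ (K : ℝ) / 2 := by
    rw [Real.coe_toNNReal _ (by positivity), Real.rpow_neg hL0.le, ← hR]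
    have h1 := ARW.pow_reach_le hd hK2
    have h2 : (K : ℝ) ^ (4 * d) * K / 4 ≤ R * K / 4 := by gcongr
    calc 2 * R⁻¹ * (2 * (K * (2 * ARW.reach d K)) + 1) ^ d ≤ 2 * R⁻¹ * (R * K / 4) := by
          gcongr; exact h1.trans h2
      _ = K / 2 := by field_simp; norm_num
  have hdisj := ARW.disjoint_innerBoundary_thicken (d := d) (L := L)
    (by linarith : ARW.reach d K + 2 ≤ R)
  refine (ARW.law_path_le hlam hdisj).trans ?_
  refine (ARW.lintegral_escape_poissonConfig_le hlam (ARW.reach_pos (by omega))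
    (by positivity) (fun ι _ _ => hK₀ K hKK₀ ι) _ _ hρ).trans ?_
  refine ENNReal.ofReal_le_ofReal ?_
  have hcard : ((ARW.latticeBox d R (L - R)).card : ℝ) ≤
      2 ^ d * (4 ^ ⌈s⌉₊ * ⌈s⌉₊.factorial * Real.exp (u / 4)) := by
    refine (ARW.card_latticeBox_le hR0.le hL).trans ?_
    rw [mul_pow]
    gcongr
    refine le_trans (le_of_eq ?_) (ARW.rpow_le_exp hu1)
    rw [hu, ← Real.rpow_mul hL0.le, ← Real.rpow_natCast]
    congr 1
    rw [hs]
    field_simp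
  have hhalf : (1 / 2 : ℝ) ^ K ≤ Real.exp (-(K / 2)) := by
    have : (1 / 2 : ℝ) ≤ Real.exp (-(1 / 2)) := by
      linarith [Real.add_one_le_exp (-(1 / 2) : ℝ)]
    calc (1 / 2 : ℝ) ^ K ≤ Real.exp (-(1 / 2)) ^ K := by gcongr
      _ = Real.exp (-(K / 2)) := by rw [← Real.exp_nat_mul]; congr 1; ring
  have hexp : Real.exp (-(K / 2)) ≤ Real.exp (1 / 2) * Real.exp (-(u / 2)) := by
    rw [← Real.exp_add]
    exact Real.exp_le_exp.2 (by linarith)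
  calc ((ARW.latticeBox d R (L - R)).card : ℝ) * (2 * (1 / 2) ^ K + Real.exp (-(K / 2)))
      ≤ 2 ^ d * (4 ^ ⌈s⌉₊ * ⌈s⌉₊.factorial * Real.exp (u / 4)) *
          (3 * (Real.exp (1 / 2) * Real.exp (-(u / 2)))) := by
        gcongr
        linarith
    _ = C' * (Real.exp (u / 4) * Real.exp (-(u / 2))) := by rw [hC']; ring
    _ = C' * Real.exp (-(1 / 4) * u) := by rw [← Real.exp_add]; congr 2; ring
    _ ≤ _ := by gcongr; linarith [Real.exp_pos ((K₁ : ℝ) / 4)]
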